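/- Let $n\ge 1$, let $q_0,\dots,q_n\in\mathbb R^n$ satisfy $|q_i-q_j|=1$ for $i\ne j$, let $F_i(x)=\frac12(x+q_i)$, and let $S_n\subset\mathbb R^n$ be the Sierpinski $n$-gasket, the unique nonempty compact set with $S_n=\bigcup_{i=0}^n F_i(S_n)$. For a finite word $w=w_1\cdots w_m$ over $\{0,\dots,n\}$ let $[w]=F_{w_1}\circ\cdots\circ F_{w_m}(S_n)$ be the corresponding cell and $|w|=m$. Let $\mu_n$ be the standard self-similar probability measure on $S_n$ (all weights equal to $\frac1{n+1}$) and $\mathcal H^1$ the one-dimensional Hausdorff measure. The length of a path $\gamma:[0,1]\to S_n$ is $|\gamma|=\mathcal H^1(\gamma([0,1]))$, $d(x,y)$ is the infimum of the lengths of the paths in $S_n$ from $x$ to $y$, and a geodesic from $x$ to $y$ is a path in $S_n$ of length $d(x,y)$ that is parametrized at constant speed. For $A,B\subseteq S_n$ and $t\in[0,1]$ put $$\tilde Z_t(A,B)=\bigcup_{a\in A,\,b\in B}\{x\in S_n: d(a,x)=t\,d(a,b),\ d(x,b)=(1-t)\,d(a,b)\}.$$ A common path from $A$ to $B$ is a path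 $\hat\gamma$ of finite length in $S_n$ such that for all $a\in A$, $b\in B$ there are a geodesic $\hat\gamma_{a\to b}$ from $a$ to $b$ and $t_1,t_2\in[0,1]$ with $\hat\gamma([0,1])=\hat\gamma_{a\to b}([t_1,t_2])$. Given a common path and a choice of such geodesics, put $Z_t(A,B)=\{\hat\gamma_{a\to b}(t):a\in A,\,b\in B\}$. Let $A=[v]$ and $B=[w]$ be disjoint cells and let $t\in[0,1]$. Then $$\mathcal H^1(\tilde Z_t(A,B))\ \ge\ (1-t)\,\mu_n(A)^{\log 2/\log(n+1)}+t\,\mu_n(B)^{\log 2/\log(n+1)},$$ and, for every common path from $A$ to $B$ and every choice of the geodesics $\hat\gamma_{a\to b}$, $$\mathcal H^1(Z_t(A,B))\ \ge\ (1-t)\,\mu_n(A)^{\log 2/\log(n+1)}+t\,\mu_n(B)^{\log 2/\log(n+1)}.$$ Both inequalities are sharp: for every $t\in(0,1)$ there is $N$ such that for all $k,m\ge N$ there are disjoint cells $A=[v]$, $B=[w]$ with $|v|=k$, $|w|=m$ for which the first inequality is an equality, and for which there are a common path and a choice of geodesics such that the second one is an equality. -/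

import Mathlib

open Set MeasureTheory Topology

open scoped ENNReal unitInterval

namespace SierpinskiGasket

noncomputable section

/-- The contraction `F_i x = (x + q_i) / 2`. -/
def contr {n : ℕ} (q : Fin (n + 1) → EuclideanSpace ℝ (Fin n)) (i : Fin (n + 1))
    (x : EuclideanSpace ℝ (Fin n)) : EuclideanSpace ℝ (Fin n) :=
  (1 / 2 : ℝ) • (x + q i)

/-- The point with infinite address `ω`, i.e. the limit of `F_{ω 0} ∘ ⋯ ∘ F_{ω m}` as `m → ∞`. -/
def point {n : ℕ} (q : Fin (n + 1) → EuclideanSpace ℝ (Fin n)) (ω : ℕ → Fin (n + 1)) :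
    EuclideanSpace ℝ (Fin n) :=
  ∑' k : ℕ, (1 / 2 : ℝ) ^ (k + 1) • q (ω k)

/-- The Sierpinski `n`-gasket `S_n` with vertices `q_0, …, q_n`, as the set of all points having an
infinite address. The facts `isCompact_gasket`, `gasket_nonempty`, `gasket_eq_iUnion` and
`eq_gasket` below show that it is the unique nonempty compact attractor of the `F_i`. -/
def gasket {n : ℕ} (q : Fin (n + 1) → EuclideanSpace ℝ (Fin n)) : Set (EuclideanSpace ℝ (Fin n)) :=
  range (point q)

/-- `F_w = F_{w_1} ∘ ⋯ ∘ F_{w_m}` for a finite address `w = w_1 ⋯ w_m`. -/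
def wordMap {n : ℕ} (q : Fin (n + 1) → EuclideanSpace ℝ (Fin n)) :
    List (Fin (n + 1)) → EuclideanSpace ℝ (Fin n) → EuclideanSpace ℝ (Fin n)
  | [] => id
  | i :: w => contr q i ∘ wordMap q w

/-- The cell `[w] = F_w(S_n)`. -/
def cell {n : ℕ} (q : Fin (n + 1) → EuclideanSpace ℝ (Fin n)) (w : List (Fin (n + 1))) :
    Set (EuclideanSpace ℝ (Fin n)) :=
  wordMap q w '' gasket q

/-- The law of a sequence of independent uniformly distributed letters. -/
def addressMeasure (n : ℕ) : Measure (ℕ → Fin (n + 1)) :=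
  Measure.infinitePi fun _ : ℕ => (ProbabilityTheory.uniformOn univ : Measure (Fin (n + 1)))

/-- The standard measure `μ_n` on `S_n`: the law of the point whose address has independent
uniformly distributed letters. By `isProbabilityMeasure_stdMeasure` and `stdMeasure_selfSimilar`
below it is a self-similar probability measure with all weights equal to `1 / (n + 1)`. -/
def stdMeasure {n : ℕ} (q : Fin (n + 1) → EuclideanSpace ℝ (Fin n)) :
    Measure (EuclideanSpace ℝ (Fin n)) :=
  (addressMeasure n).map (point q)

/-- The length `|γ| = H¹(γ([0,1]))` of a path. -/
def pathLength {n : ℕ} {x y : EuclideanSpace ℝ (Fin n)} (γ : Path x y) : ℝ≥0∞ :=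
  Measure.hausdorffMeasure 1 (range γ)

/-- The intrinsic metric of `S_n`, the infimum of the lengths of the paths in `S_n` from `x`
to `y`. -/
def intrinsicDist {n : ℕ} (q : Fin (n + 1) → EuclideanSpace ℝ (Fin n))
    (x y : EuclideanSpace ℝ (Fin n)) : ℝ≥0∞ :=
  ⨅ (γ : Path x y) (_ : ∀ s, γ s ∈ gasket q), pathLength γ

/-- A geodesic of `S_n`: a path in `S_n` of minimal length, parametrized at constant speed. -/
def IsGeodesic {n : ℕ} (q : Fin (n + 1) → EuclideanSpace ℝ (Fin n))
    {x y : EuclideanSpace ℝ (Fin n)} (γ : Path x y) : Prop :=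
  (∀ s, γ s ∈ gasket q) ∧ pathLength γ = intrinsicDist q x y ∧
    ∀ s : I, Measure.hausdorffMeasure 1 (γ '' Iic s) = ENNReal.ofReal (s : ℝ) * pathLength γ

/-- The interpolant `Z̃_t(a, b)` of two points. -/
def fullInterpPt {n : ℕ} (q : Fin (n + 1) → EuclideanSpace ℝ (Fin n)) (t : I)
    (a b : EuclideanSpace ℝ (Fin n)) : Set (EuclideanSpace ℝ (Fin n)) :=
  {x | x ∈ gasket q ∧
    intrinsicDist q a x = ENNReal.ofReal (t : ℝ) * intrinsicDist q a b ∧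
    intrinsicDist q x b = ENNReal.ofReal (1 - (t : ℝ)) * intrinsicDist q a b}

/-- The interpolant `Z̃_t(A, B)` of two sets. -/
def fullInterp {n : ℕ} (q : Fin (n + 1) → EuclideanSpace ℝ (Fin n)) (t : I)
    (A B : Set (EuclideanSpace ℝ (Fin n))) : Set (EuclideanSpace ℝ (Fin n)) :=
  ⋃ a ∈ A, ⋃ b ∈ B, fullInterpPt q t a b

/-- The path `c` is a common path from `A` to `B`: it is a path in `S_n` of finite length, and
for all `a ∈ A`, `b ∈ B` the path `Γ a b` is a geodesic from `a` to `b` that contains `c`, namely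
between an entry time `t₁` and an exit time `t₂`. Only the values `Γ a b` with `a ∈ A`, `b ∈ B`
matter. -/
def IsCommonPath {n : ℕ} (q : Fin (n + 1) → EuclideanSpace ℝ (Fin n))
    (A B : Set (EuclideanSpace ℝ (Fin n))) {x y : EuclideanSpace ℝ (Fin n)} (c : Path x y)
    (Γ : ∀ a b : EuclideanSpace ℝ (Fin n), Path a b) : Prop :=
  (∀ s, c s ∈ gasket q) ∧ pathLength c < ⊤ ∧
    ∀ a ∈ A, ∀ b ∈ B, IsGeodesic q (Γ a b) ∧ ∃ t₁ t₂ : I, range c = Γ a b '' Icc t₁ t₂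

/-- The modified interpolant `Z_t(A, B)`, where `Z_t(a, b)` is the point at time `t` on the chosen
geodesic `Γ a b` from `a` to `b`. -/
def interp {n : ℕ} (Γ : ∀ a b : EuclideanSpace ℝ (Fin n), Path a b) (t : I)
    (A B : Set (EuclideanSpace ℝ (Fin n))) : Set (EuclideanSpace ℝ (Fin n)) :=
  {z | ∃ a ∈ A, ∃ b ∈ B, z = Γ a b t}

/-- The lower bound `(1 - t) μ_n(A)^{log 2 / log (n+1)} + t μ_n(B)^{log 2 / log (n+1)}`. -/
def lowerBound {n : ℕ} (q : Fin (n + 1) → EuclideanSpace ℝ (Fin n)) (t : I)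
    (A B : Set (EuclideanSpace ℝ (Fin n))) : ℝ :=
  (1 - (t : ℝ)) * (stdMeasure q).real A ^ (Real.log 2 / Real.log ((n : ℝ) + 1)) +
    (t : ℝ) * (stdMeasure q).real B ^ (Real.log 2 / Real.log ((n : ℝ) + 1))

/-! Checks that `gasket` and `stdMeasure` are the objects intended. -/

theorem summable_point_bound {n : ℕ} (q : Fin (n + 1) → EuclideanSpace ℝ (Fin n)) :
    Summable fun k : ℕ => (1 / 2 : ℝ) ^ (k + 1) * ∑ i, ‖q i‖ := by
  refine Summable.mul_right _ ?_
  exact (summable_nat_add_iff 1).2 summable_geometric_two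

theorem norm_point_term_le {n : ℕ} (q : Fin (n + 1) → EuclideanSpace ℝ (Fin n)) (k : ℕ)
    (ω : ℕ → Fin (n + 1)) :
    ‖(1 / 2 : ℝ) ^ (k + 1) • q (ω k)‖ ≤ (1 / 2 : ℝ) ^ (k + 1) * ∑ i, ‖q i‖ := by
  rw [norm_smul, Real.norm_of_nonneg (by positivity)]
  gcongr
  exact Finset.single_le_sum (f := fun i => ‖q i‖) (fun i _ => norm_nonneg _)
    (Finset.mem_univ (ω k))

theorem continuous_point {n : ℕ} (q : Fin (n + 1) → EuclideanSpace ℝ (Fin n)) :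
    Continuous (point q) := by
  refine continuous_tsum (fun k => ?_) (summable_point_bound q) (norm_point_term_le q)
  have h : Continuous fun ω : ℕ → Fin (n + 1) => q (ω k) :=
    (continuous_of_discreteTopology (f := q)).comp (continuous_apply k)
  exact h.const_smul ((1 / 2 : ℝ) ^ (k + 1))

/-- Prefixing the letter `i` to an address. -/
def prefixLetter {n : ℕ} (i : Fin (n + 1)) (ω : ℕ → Fin (n + 1)) : ℕ → Fin (n + 1)
  | 0 => i
  | k + 1 => ω k

theorem point_prefixLetter {n : ℕ} (q : Fin (n + 1) → EuclideanSpace ℝ (Fin n)) (i : Fin (n + 1))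
    (ω : ℕ → Fin (n + 1)) : point q (prefixLetter i ω) = contr q i (point q ω) := by
  have hs : ∀ ω : ℕ → Fin (n + 1), Summable fun k : ℕ => (1 / 2 : ℝ) ^ (k + 1) • q (ω k) := fun ω =>
    Summable.of_norm_bounded (summable_point_bound q) fun k => norm_point_term_le q k ω
  unfold point contr
  rw [(hs _).tsum_eq_zero_add, smul_add, ← (hs ω).tsum_const_smul, add_comm]
  congr 1
  · refine tsum_congr fun k => ?_
    rw [smul_smul, ← pow_succ']
    rfl
  · simp [prefixLetter]

theorem isCompact_gasket {n : ℕ} (q : Fin (n + 1) → EuclideanSpace ℝ (Fin n)) :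
    IsCompact (gasket q) :=
  isCompact_range (continuous_point q)

theorem gasket_nonempty {n : ℕ} (q : Fin (n + 1) → EuclideanSpace ℝ (Fin n)) :
    (gasket q).Nonempty :=
  range_nonempty _

theorem gasket_eq_iUnion {n : ℕ} (q : Fin (n + 1) → EuclideanSpace ℝ (Fin n)) :
    gasket q = ⋃ i, contr q i '' gasket q := by
  ext x
  simp only [mem_iUnion]
  constructor
  · rintro ⟨ω, rfl⟩
    refine ⟨ω 0, point q (fun k => ω (k + 1)), ⟨_, rfl⟩, ?_⟩
    rw [← point_prefixLetter]
    congr 1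
    ext k
    cases k <;> rfl
  · rintro ⟨i, _, ⟨ω, rfl⟩, rfl⟩
    exact ⟨prefixLetter i ω, point_prefixLetter q i ω⟩

theorem dist_contr {n : ℕ} (q : Fin (n + 1) → EuclideanSpace ℝ (Fin n)) (i : Fin (n + 1))
    (x y : EuclideanSpace ℝ (Fin n)) : dist (contr q i x) (contr q i y) = 1 / 2 * dist x y := by
  unfold contr
  rw [dist_smul₀, dist_add_right, Real.norm_of_nonneg (by norm_num)]

theorem infDist_le_of_invariant {n : ℕ} (q : Fin (n + 1) → EuclideanSpace ℝ (Fin n))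
    {K L : Set (EuclideanSpace ℝ (Fin n))} (hK : IsCompact K) (hL : IsCompact L)
    (hLne : L.Nonempty) (hKi : K = ⋃ i, contr q i '' K) (hLi : L = ⋃ i, contr q i '' L) :
    K ⊆ L := by
  rcases K.eq_empty_or_nonempty with rfl | hKne
  · exact empty_subset _
  obtain ⟨x, hx, hmax⟩ := hK.exists_isMaxOn hKne (Metric.continuous_infDist_pt L).continuousOn
  have h0 : Metric.infDist x L ≤ 1 / 2 * Metric.infDist x L := by
    have hx' := hx
    rw [hKi] at hx'
    obtain ⟨i, y, hy, rfl⟩ := mem_iUnion.1 hx'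
    obtain ⟨z, hz, hyz⟩ := hL.exists_infDist_eq_dist hLne y
    have hz' : contr q i z ∈ L := by
      rw [hLi]
      exact mem_iUnion.2 ⟨i, z, hz, rfl⟩
    calc Metric.infDist (contr q i y) L ≤ dist (contr q i y) (contr q i z) :=
          Metric.infDist_le_dist_of_mem hz'
      _ = 1 / 2 * Metric.infDist y L := by rw [dist_contr, hyz]
      _ ≤ 1 / 2 * Metric.infDist (contr q i y) L := by
          have := hmax hy
          simp only [mem_ofPred_eq] at this
          linarith
  intro y hy
  have h1 := hmax hy
  simp only [mem_ofPred_eq] at h1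
  have h2 : Metric.infDist y L = 0 :=
    le_antisymm (by linarith) Metric.infDist_nonneg
  exact (hL.isClosed.mem_iff_infDist_zero hLne).2 h2

theorem eq_gasket {n : ℕ} (q : Fin (n + 1) → EuclideanSpace ℝ (Fin n))
    {K : Set (EuclideanSpace ℝ (Fin n))} (hK : IsCompact K) (hne : K.Nonempty)
    (hKi : K = ⋃ i, contr q i '' K) : K = gasket q :=
  (infDist_le_of_invariant q hK (isCompact_gasket q) (gasket_nonempty q) hKi
    (gasket_eq_iUnion q)).antisymm
  (infDist_le_of_invariant q (isCompact_gasket q) hK hne (gasket_eq_iUnion q) hKi)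

instance isProbabilityMeasure_uniform (n : ℕ) :
    IsProbabilityMeasure (ProbabilityTheory.uniformOn univ : Measure (Fin (n + 1))) :=
  ProbabilityTheory.isProbabilityMeasure_uniformOn finite_univ univ_nonempty

instance isProbabilityMeasure_addressMeasure (n : ℕ) : IsProbabilityMeasure (addressMeasure n) := by
  unfold addressMeasure
  infer_instance

instance isProbabilityMeasure_stdMeasure {n : ℕ} (q : Fin (n + 1) → EuclideanSpace ℝ (Fin n)) :
    IsProbabilityMeasure (stdMeasure q) :=
  Measure.isProbabilityMeasure_map (continuous_point q).measurable.aemeasurable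

theorem measurable_prefixLetter (n : ℕ) :
    Measurable fun p : Fin (n + 1) × (ℕ → Fin (n + 1)) => prefixLetter p.1 p.2 := by
  refine measurable_pi_lambda _ fun k => ?_
  cases k with
  | zero => exact measurable_fst
  | succ k => exact (measurable_pi_apply k).comp measurable_snd

theorem map_prefixLetter (n : ℕ) :
    ((ProbabilityTheory.uniformOn univ : Measure (Fin (n + 1))).prod (addressMeasure n)).map
      (fun p => prefixLetter p.1 p.2) = addressMeasure n := by
  classical
  refine Measure.eq_infinitePi _ fun s t ht => ?_
  obtain ⟨M, hM⟩ : ∃ M : ℕ, s ⊆ Finset.range (M + 1) := by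
    obtain ⟨M, hM⟩ := s.exists_nat_subset_range
    exact ⟨M, hM.trans (Finset.range_mono (Nat.le_succ M))⟩
  set t' : ℕ → Set (Fin (n + 1)) := fun k => if k ∈ s then t k else univ with ht'
  have hpre : (fun p : Fin (n + 1) × (ℕ → Fin (n + 1)) => prefixLetter p.1 p.2) ⁻¹' Set.pi s t =
      t' 0 ×ˢ Set.pi (Finset.range M : Set ℕ) (fun k => t' (k + 1)) := by
    ext ⟨i, ω⟩
    simp only [mem_preimage, Set.mem_pi, mem_prod, Finset.mem_coe, Finset.mem_range, ht']
    constructor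
    · intro h
      refine ⟨?_, fun k _ => ?_⟩
      · split_ifs with h0
        · exact h 0 h0
        · trivial
      · split_ifs with h1
        · exact h (k + 1) h1
        · trivial
    · rintro ⟨h0, h1⟩ k hk
      cases k with
      | zero => simpa [hk, prefixLetter] using h0
      | succ k =>
        have h2 := h1 k (by have := Finset.mem_range.1 (hM hk); omega)
        simpa [hk, prefixLetter] using h2
  rw [Measure.map_apply (measurable_prefixLetter n)
    (MeasurableSet.pi s.countable_toSet fun i _ => ht i), hpre, Measure.prod_prod]
  unfold addressMeasure
  rw [Measure.infinitePi_pi _ (fun i _ => MeasurableSet.of_discrete), mul_comm,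
    ← Finset.prod_range_succ' (fun k => (ProbabilityTheory.uniformOn univ) (t' k)) M]
  rw [← Finset.prod_subset hM]
  · refine Finset.prod_congr rfl fun k hk => ?_
    simp [ht', hk]
  · intro k _ hk
    simp [ht', hk, measure_univ]

theorem stdMeasure_selfSimilar {n : ℕ} (q : Fin (n + 1) → EuclideanSpace ℝ (Fin n))
    {X : Set (EuclideanSpace ℝ (Fin n))} (hX : MeasurableSet X) :
    stdMeasure q X = ∑ i, (1 / ((n : ℝ≥0∞) + 1)) * stdMeasure q (contr q i ⁻¹' X) := by
  have hp := (continuous_point q).measurable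
  have hc : ∀ i, Measurable (contr q i) := fun i => by
    unfold contr
    fun_prop
  unfold stdMeasure
  simp only [Measure.map_apply hp hX, Measure.map_apply hp (hc _ hX)]
  conv_lhs => rw [← map_prefixLetter n]
  rw [Measure.map_apply (measurable_prefixLetter n) (hp hX),
    Measure.prod_apply (measurable_prefixLetter n (hp hX)), lintegral_fintype]
  refine Finset.sum_congr rfl fun i _ => ?_
  rw [mul_comm]
  congr 1
  · rw [ProbabilityTheory.uniformOn_univ]
    simp
  · congr 1
    ext ω
    simp only [mem_preimage, point_prefixLetter]

end

end SierpinskiGasket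

namespace SierpinskiGasket

noncomputable section

/-! A cell has measure `(n+1)^(-|w|)`, and the exponent `log 2 / log (n+1)` turns this into the side
length `2^(-|w|)`. So the bound is `(1-t)δ + tε`, where `δ` and `ε` are the side lengths of `A` and
`B`.

Lower bound. The words of disjoint cells have the form `v = u i v'` and `w = u j w'` with `i ≠ j`.
From the corner `i` of `[v]` some geodesic towards a given point of `[uj]` starts with a full edge
of `[v]` (`exists_edge_toward`), and symmetrically for `[w]`. Hence some geodesic starts with an
edge of `[v]` and ends with an edge of `[w]`. When `a` and `b` move along these two edges, the
triangle inequality forces the distance from the end of the geodesic to any point at parameter `t`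
between `a` and `b`, and this distance sweeps out an interval of length `(1-t)δ + tε`
(`ofReal_le_hausdorffMeasure_of_between`). The intrinsic distance is not 1-Lipschitz for the
Euclidean metric, but it is on every straight edge of a cell, and interior points of geodesics lie
on these countably many edges (`exists_mem_edge_of_between`).

Distances. `arcDist` is the least travel time at speed at most one. A function whose oscillation on
each small cell is at most the side of the cell varies on a connected set by at most its `H¹`
measure (`ofReal_abs_sub_le_hausdorffMeasure`). Three choices of the function are used. `arcDist q
x` shows that `arcDist` is the intrinsic metric; a barycentric coordinate gives the exact distance
to the corners of a cell; a function glued along a cell shows that curves leave the cell through its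
corners.

Sharpness. For the cells `[i^k]` and `[j^m]` at two vertices, geodesics follow the edge from `q i`
to `q j` away from their ends, and the points at parameter `t` fill at most an interval of that edge
of exactly the required length (`hausdorffMeasure_fullInterp_le`). The middle half of the edge is a
common path. -/

/-! ### Barycentric coordinates -/

/-- The barycentric coordinate of `x` belonging to the vertex `q i` of a regular simplex of edge
length one. -/
def bary {n : ℕ} (q : Fin (n + 1) → EuclideanSpace ℝ (Fin n)) (i : Fin (n + 1))
    (x : EuclideanSpace ℝ (Fin n)) : ℝ :=
  (1 + ∑ j, (dist x (q j) ^ 2 - dist x (q i) ^ 2)) / ((n : ℝ) + 1)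

variable {n : ℕ} {q : Fin (n + 1) → EuclideanSpace ℝ (Fin n)}

theorem continuous_bary (i : Fin (n + 1)) : Continuous (bary q i) := by
  unfold bary
  fun_prop

theorem sum_bary (x : EuclideanSpace ℝ (Fin n)) : ∑ i, bary q i x = 1 := by
  have hn : (n : ℝ) + 1 ≠ 0 := by positivity
  unfold bary
  rw [← Finset.sum_div, div_eq_one_iff_eq hn]
  simp [Finset.sum_add_distrib, Finset.sum_sub_distrib, ← Finset.mul_sum]

theorem bary_vertex (hq : ∀ i j, i ≠ j → dist (q i) (q j) = 1) (i l : Fin (n + 1)) :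
    bary q i (q l) = if l = i then 1 else 0 := by
  have hn : (n : ℝ) + 1 ≠ 0 := by positivity
  have h : ∀ j, dist (q l) (q j) ^ 2 = 1 - if l = j then (1 : ℝ) else 0 := by
    intro j
    split_ifs with hj
    · simp [hj]
    · simp [hq l j hj]
  unfold bary
  simp only [h, Finset.sum_sub_distrib, Finset.sum_const, Finset.sum_ite_eq, Finset.mem_univ,
    if_true, Finset.card_univ, Fintype.card_fin, nsmul_eq_mul]
  rw [div_eq_iff hn]
  push_cast
  split_ifs <;> ring

theorem dist_sq_sub_dist_sq (x a b : EuclideanSpace ℝ (Fin n)) :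
    dist x a ^ 2 - dist x b ^ 2 = 2 * inner ℝ x (b - a) + (‖a‖ ^ 2 - ‖b‖ ^ 2) := by
  rw [dist_eq_norm, dist_eq_norm, @norm_sub_sq_real, @norm_sub_sq_real, inner_sub_right]
  ring

/-- In each difference of squared distances the term `‖x‖ ^ 2` cancels, so the coordinate is affine
in `x`. -/
theorem bary_combination (i : Fin (n + 1)) (c : ℝ) (x y : EuclideanSpace ℝ (Fin n)) :
    bary q i ((1 - c) • x + c • y) = (1 - c) * bary q i x + c * bary q i y := by
  have hn : (n : ℝ) + 1 ≠ 0 := by positivity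
  unfold bary
  simp only [dist_sq_sub_dist_sq, inner_add_left, real_inner_smul_left, Finset.sum_add_distrib,
    ← Finset.mul_sum]
  field_simp
  ring

theorem bary_contr (hq : ∀ i j, i ≠ j → dist (q i) (q j) = 1) (i j : Fin (n + 1))
    (x : EuclideanSpace ℝ (Fin n)) :
    bary q i (contr q j x) = (bary q i x + if j = i then 1 else 0) / 2 := by
  have h : contr q j x = (1 - (1 / 2 : ℝ)) • x + (1 / 2 : ℝ) • q j := by
    unfold contr
    rw [smul_add]
    norm_num
  rw [h, bary_combination, bary_vertex hq]
  ring

/-! ### Words and cells -/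

theorem contr_vertex (i : Fin (n + 1)) : contr q i (q i) = q i := by
  unfold contr
  rw [← two_smul ℝ, smul_smul]
  norm_num

theorem contr_vertex_comm (i j : Fin (n + 1)) : contr q i (q j) = contr q j (q i) := by
  unfold contr
  rw [add_comm]

theorem contr_injective (i : Fin (n + 1)) : Function.Injective (contr q i) := by
  intro x y h
  have := dist_contr q i x y
  rw [h, dist_self] at this
  exact dist_eq_zero.1 (by linarith)

theorem contr_mem_gasket (i : Fin (n + 1)) {x : EuclideanSpace ℝ (Fin n)} (hx : x ∈ gasket q) :
    contr q i x ∈ gasket q := by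
  rw [gasket_eq_iUnion]
  exact mem_iUnion.2 ⟨i, x, hx, rfl⟩

theorem exists_contr_of_mem_gasket {x : EuclideanSpace ℝ (Fin n)} (hx : x ∈ gasket q) :
    ∃ i, ∃ y ∈ gasket q, x = contr q i y := by
  rw [gasket_eq_iUnion] at hx
  obtain ⟨i, y, hy, rfl⟩ := mem_iUnion.1 hx
  exact ⟨i, y, hy, rfl⟩

theorem dist_wordMap (w : List (Fin (n + 1))) (x y : EuclideanSpace ℝ (Fin n)) :
    dist (wordMap q w x) (wordMap q w y) = (1 / 2 : ℝ) ^ w.length * dist x y := by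
  induction w with
  | nil => simp [wordMap]
  | cons i w ih =>
    simp only [wordMap, Function.comp, dist_contr, ih, List.length_cons]
    ring

theorem continuous_wordMap (w : List (Fin (n + 1))) : Continuous (wordMap q w) := by
  refine (LipschitzWith.of_dist_le_mul (K := ((1 / 2) ^ w.length)) fun x y => ?_).continuous
  rw [dist_wordMap]
  simp

theorem wordMap_injective (w : List (Fin (n + 1))) : Function.Injective (wordMap q w) := by
  intro x y h
  have := dist_wordMap (q := q) w x y
  rw [h, dist_self] at this
  have h2 : (0 : ℝ) < (1 / 2) ^ w.length := by positivity
  exact dist_eq_zero.1 (by nlinarith [mul_eq_zero.1 this.symm])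

theorem wordMap_append (u v : List (Fin (n + 1))) :
    wordMap q (u ++ v) = wordMap q u ∘ wordMap q v := by
  induction u with
  | nil => rfl
  | cons i u ih => simp only [List.cons_append, wordMap, ih, Function.comp_assoc]

theorem wordMap_mem_gasket (w : List (Fin (n + 1))) {x : EuclideanSpace ℝ (Fin n)}
    (hx : x ∈ gasket q) : wordMap q w x ∈ gasket q := by
  induction w with
  | nil => exact hx
  | cons i w ih => exact contr_mem_gasket i ih

theorem cell_subset_gasket (w : List (Fin (n + 1))) : cell q w ⊆ gasket q := by
  rintro _ ⟨x, hx, rfl⟩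
  exact wordMap_mem_gasket w hx

theorem isCompact_cell (w : List (Fin (n + 1))) : IsCompact (cell q w) :=
  (isCompact_gasket q).image (continuous_wordMap w)

theorem cell_append (u v : List (Fin (n + 1))) :
    cell q (u ++ v) = wordMap q u '' cell q v := by
  unfold cell
  rw [wordMap_append, image_comp]

theorem cell_append_subset (u v : List (Fin (n + 1))) : cell q (u ++ v) ⊆ cell q u := by
  rw [cell_append]
  exact image_mono (cell_subset_gasket v)

theorem exists_cell_of_mem_gasket (N : ℕ) {x : EuclideanSpace ℝ (Fin n)} (hx : x ∈ gasket q) :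
    ∃ w : List (Fin (n + 1)), w.length = N ∧ x ∈ cell q w := by
  induction N generalizing x with
  | zero => exact ⟨[], rfl, x, hx, rfl⟩
  | succ N ih =>
    obtain ⟨i, y, hy, rfl⟩ := exists_contr_of_mem_gasket hx
    obtain ⟨w, hw, z, hz, rfl⟩ := ih hy
    exact ⟨i :: w, by simp [hw], z, hz, rfl⟩

theorem wordMap_replicate_vertex (N : ℕ) (l : Fin (n + 1)) :
    wordMap q (List.replicate N l) (q l) = q l := by
  induction N with
  | zero => rfl
  | succ N ih => simp only [List.replicate_succ, wordMap, Function.comp, ih, contr_vertex]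

theorem vertex_mem_gasket (l : Fin (n + 1)) : q l ∈ gasket q := by
  obtain ⟨x, hx⟩ := gasket_nonempty q
  refine (isCompact_gasket q).isClosed.mem_of_tendsto (b := Filter.atTop)
    (f := fun N => wordMap q (List.replicate N l) x) ?_ (Filter.Eventually.of_forall fun N =>
      wordMap_mem_gasket _ hx)
  rw [tendsto_iff_dist_tendsto_zero]
  have : ∀ N, dist (wordMap q (List.replicate N l) x) (q l) = (1 / 2 : ℝ) ^ N * dist x (q l) := by
    intro N
    conv_lhs => rw [← wordMap_replicate_vertex (q := q) N l]
    rw [dist_wordMap, List.length_replicate]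
  simp only [this]
  simpa using (tendsto_pow_atTop_nhds_zero_of_lt_one (by norm_num : (0 : ℝ) ≤ 1 / 2)
    (by norm_num)).mul_const (dist x (q l))

theorem wordMap_vertex_mem_cell (w : List (Fin (n + 1))) (l : Fin (n + 1)) :
    wordMap q w (q l) ∈ cell q w :=
  ⟨_, vertex_mem_gasket l, rfl⟩

/-- A closed set that contains the vertices and is mapped to itself by all `F_i` contains the
gasket. -/
theorem gasket_subset_of_isClosed {T : Set (EuclideanSpace ℝ (Fin n))} (hT : IsClosed T)
    (hv : ∀ l, q l ∈ T) (hc : ∀ i, ∀ x ∈ T, contr q i x ∈ T) : gasket q ⊆ T := by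
  intro x hx
  choose w hw y hy hxy using fun N => exists_cell_of_mem_gasket N hx
  have hmem : ∀ w : List (Fin (n + 1)), wordMap q w (q 0) ∈ T := by
    intro w
    induction w with
    | nil => exact hv 0
    | cons i w ih => exact hc i _ ih
  obtain ⟨M, hM⟩ := (isCompact_gasket q).isBounded.exists_norm_le
  refine hT.mem_of_tendsto (b := Filter.atTop) (f := fun N => wordMap q (w N) (q 0)) ?_
    (Filter.Eventually.of_forall fun N => hmem _)
  rw [tendsto_iff_dist_tendsto_zero]
  refine squeeze_zero (fun _ => dist_nonneg) (g := fun N => (1 / 2 : ℝ) ^ N * (M + M))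
    (fun N => ?_) ?_
  · conv_lhs => rw [← hxy N]
    rw [dist_wordMap, hw]
    gcongr
    exact (dist_le_norm_add_norm _ _).trans (add_le_add (hM _ (vertex_mem_gasket 0)) (hM _ (hy N)))
  · simpa using (tendsto_pow_atTop_nhds_zero_of_lt_one (by norm_num : (0 : ℝ) ≤ 1 / 2)
      (by norm_num)).mul_const (M + M)

theorem dist_vertex_le_one (hq : ∀ i j, i ≠ j → dist (q i) (q j) = 1) (l : Fin (n + 1))
    {x : EuclideanSpace ℝ (Fin n)} (hx : x ∈ gasket q) : dist x (q l) ≤ 1 := by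
  have hv : ∀ i, dist (q i) (q l) ≤ 1 := by
    intro i
    rcases eq_or_ne i l with rfl | h
    · simp
    · exact (hq i l h).le
  refine gasket_subset_of_isClosed (T := {x | dist x (q l) ≤ 1})
    (isClosed_le (by fun_prop) continuous_const) hv (fun i x hx => ?_) hx
  have h1 : dist (contr q i x) (contr q i (q l)) = 1 / 2 * dist x (q l) := dist_contr q i x (q l)
  have h2 : dist (contr q i (q l)) (q l) = 1 / 2 * dist (q i) (q l) := by
    rw [contr_vertex_comm, ← dist_contr q l, contr_vertex]
  have h3 : dist x (q l) ≤ 1 := hx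
  have h4 := dist_triangle (contr q i x) (contr q i (q l)) (q l)
  have h5 := hv i
  change dist (contr q i x) (q l) ≤ 1
  linarith

theorem bary_nonneg (hq : ∀ i j, i ≠ j → dist (q i) (q j) = 1) (i : Fin (n + 1))
    {x : EuclideanSpace ℝ (Fin n)} (hx : x ∈ gasket q) : 0 ≤ bary q i x := by
  refine gasket_subset_of_isClosed (T := {x | 0 ≤ bary q i x})
    (isClosed_le continuous_const (continuous_bary i)) (fun l => ?_) (fun j x hx => ?_) hx
  · change 0 ≤ bary q i (q l)
    rw [bary_vertex hq]
    split_ifs <;> norm_num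
  · change 0 ≤ bary q i (contr q j x)
    have : 0 ≤ bary q i x := hx
    rw [bary_contr hq]
    split_ifs <;> linarith

theorem bary_add_le_one (hq : ∀ i j, i ≠ j → dist (q i) (q j) = 1) {i j : Fin (n + 1)}
    (hij : i ≠ j) {x : EuclideanSpace ℝ (Fin n)} (hx : x ∈ gasket q) :
    bary q i x + bary q j x ≤ 1 := by
  rw [← sum_bary (q := q) x, ← Finset.sum_pair (f := fun k => bary q k x) hij]
  exact Finset.sum_le_sum_of_subset_of_nonneg (Finset.subset_univ _) fun k _ _ =>
    bary_nonneg hq k hx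

theorem bary_le_one (hq : ∀ i j, i ≠ j → dist (q i) (q j) = 1) (i : Fin (n + 1))
    {x : EuclideanSpace ℝ (Fin n)} (hx : x ∈ gasket q) : bary q i x ≤ 1 := by
  rw [← sum_bary (q := q) x]
  exact Finset.single_le_sum (f := fun i => bary q i x) (fun k _ => bary_nonneg hq k hx)
    (Finset.mem_univ i)

/-- The identity is a closed condition, holds at the vertices and survives every `F_j`; this
replaces an argument with affine independence. -/
theorem sum_bary_smul (hq : ∀ i j, i ≠ j → dist (q i) (q j) = 1)
    {x : EuclideanSpace ℝ (Fin n)} (hx : x ∈ gasket q) : ∑ i, bary q i x • q i = x := by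
  refine gasket_subset_of_isClosed (T := {x | ∑ i, bary q i x • q i = x})
    (isClosed_eq (continuous_finsetSum _ fun i _ => (continuous_bary i).smul continuous_const)
      continuous_id) (fun l => ?_) (fun j x hx => ?_) hx
  · change ∑ i, bary q i (q l) • q i = q l
    simp [bary_vertex hq]
  · change ∑ i, bary q i (contr q j x) • q i = contr q j x
    have h : ∑ i, bary q i x • q i = x := hx
    have h1 : ∑ i, (if j = i then (1 : ℝ) else 0) • q i = q j := by simp
    conv_rhs => rw [contr, ← h1, ← h]
    rw [← Finset.sum_add_distrib, Finset.smul_sum]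
    refine Finset.sum_congr rfl fun i _ => ?_
    rw [bary_contr hq, ← add_smul, smul_smul, ← h, h]
    congr 1
    ring

/-- A point of the gasket two of whose barycentric coordinates add up to one lies on an edge. -/
theorem eq_combination_of_bary (hq : ∀ i j, i ≠ j → dist (q i) (q j) = 1) {i j : Fin (n + 1)}
    (hij : i ≠ j) {x : EuclideanSpace ℝ (Fin n)} (hx : x ∈ gasket q)
    (h : 1 ≤ bary q i x + bary q j x) : x = (1 - bary q j x) • q i + bary q j x • q j := by
  have h1 : ∑ k ∈ Finset.univ \ {i, j}, bary q k x = 0 := by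
    have := Finset.sum_sdiff (f := fun k => bary q k x) (Finset.subset_univ {i, j})
    rw [sum_bary, Finset.sum_pair hij] at this
    have h2 : 0 ≤ ∑ k ∈ Finset.univ \ {i, j}, bary q k x :=
      Finset.sum_nonneg fun k _ => bary_nonneg hq k hx
    linarith
  have h2 : bary q i x = 1 - bary q j x := by
    have := bary_add_le_one hq hij hx
    linarith
  have h3 := (Finset.sum_eq_zero_iff_of_nonneg fun k _ => bary_nonneg hq k hx).1 h1
  conv_lhs => rw [← sum_bary_smul hq hx]
  rw [← Finset.sum_sdiff (Finset.subset_univ {i, j}), Finset.sum_pair hij, h2,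
    Finset.sum_eq_zero fun k hk => by rw [h3 k hk, zero_smul], zero_add]

theorem eq_vertex_of_bary (hq : ∀ i j, i ≠ j → dist (q i) (q j) = 1) {i : Fin (n + 1)}
    {x : EuclideanSpace ℝ (Fin n)} (hx : x ∈ gasket q) (h : 1 ≤ bary q i x) : x = q i := by
  have h0 : ∀ k, k ≠ i → bary q k x = 0 := by
    intro k hk
    have := bary_add_le_one hq hk hx
    have := bary_nonneg hq k hx
    linarith
  have h1 : bary q i x = 1 := le_antisymm (bary_le_one hq i hx) h
  conv_lhs => rw [← sum_bary_smul hq hx]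
  rw [Finset.sum_eq_single i (fun k _ hk => by rw [h0 k hk, zero_smul]) (by simp), h1, one_smul]

/-- The coordinate `j` is at most `1/2` on the subcell `i` and at least `1/2` on the subcell `j`. So
the two subcells can meet only in the midpoint `F_i (q j)`. -/
theorem eq_vertex_of_contr_eq (hq : ∀ i j, i ≠ j → dist (q i) (q j) = 1) {i j : Fin (n + 1)}
    (hij : i ≠ j) {x y : EuclideanSpace ℝ (Fin n)} (hx : x ∈ gasket q) (hy : y ∈ gasket q)
    (h : contr q i x = contr q j y) : x = q j := by
  refine eq_vertex_of_bary hq hx ?_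
  have h1 := congrArg (bary q j) h
  rw [bary_contr hq, bary_contr hq, if_neg hij, if_pos rfl] at h1
  have := bary_nonneg hq j hy
  linarith

theorem bary_wordMap_sub (hq : ∀ i j, i ≠ j → dist (q i) (q j) = 1) (i : Fin (n + 1))
    (w : List (Fin (n + 1))) (x y : EuclideanSpace ℝ (Fin n)) :
    bary q i (wordMap q w x) - bary q i (wordMap q w y) =
      (1 / 2 : ℝ) ^ w.length * (bary q i x - bary q i y) := by
  induction w with
  | nil => simp [wordMap]
  | cons j w ih =>
    simp only [wordMap, Function.comp, bary_contr hq, List.length_cons, pow_succ]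
    linear_combination (1 / 2) * ih

theorem vertex_injective (hq : ∀ i j, i ≠ j → dist (q i) (q j) = 1) {i j : Fin (n + 1)}
    (h : q i = q j) : i = j := by
  by_contra hij
  have := hq i j hij
  simp [h] at this

/-- All letters of such a word are equal to `l`, and `F_l` fixes `q l`. -/
theorem wordMap_vertex_of_mem_cell (hq : ∀ i j, i ≠ j → dist (q i) (q j) = 1)
    {l : Fin (n + 1)} {w : List (Fin (n + 1))} (h : q l ∈ cell q w) : wordMap q w (q l) = q l := by
  induction w with
  | nil => rfl
  | cons i w ih =>
    obtain ⟨y, hy, hyl⟩ := h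
    simp only [wordMap, Function.comp] at hyl
    have hil : i = l := by
      by_contra hil
      have := eq_vertex_of_contr_eq hq (Ne.symm hil) (vertex_mem_gasket l)
        (wordMap_mem_gasket w hy) (by rw [contr_vertex]; exact hyl.symm)
      exact hil (vertex_injective hq this).symm
    subst hil
    have h2 : wordMap q w y = q i := contr_injective i (by rw [hyl, contr_vertex])
    simp only [wordMap, Function.comp, ih ⟨y, hy, h2⟩, contr_vertex]

/-- Two different cells of the same generation meet in vertices only. -/
theorem exists_vertex_of_mem_cells (hq : ∀ i j, i ≠ j → dist (q i) (q j) = 1)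
    {u w : List (Fin (n + 1))} (hl : u.length = w.length) (hne : u ≠ w)
    {x : EuclideanSpace ℝ (Fin n)} (hu : x ∈ cell q u) (hw : x ∈ cell q w) :
    ∃ l, x = wordMap q u (q l) := by
  induction u generalizing w x with
  | nil =>
    cases w with
    | nil => exact absurd rfl hne
    | cons j w => simp at hl
  | cons i u ih =>
    cases w with
    | nil => simp at hl
    | cons j w =>
      obtain ⟨y, hy, rfl⟩ := hu
      obtain ⟨z, hz, hzy⟩ := hw
      simp only [wordMap, Function.comp] at hzy ⊢
      rcases eq_or_ne i j with rfl | hij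
      · have h1 := contr_injective i hzy
        obtain ⟨l, hl⟩ := ih (by simpa using hl) (fun h => hne (by rw [h])) ⟨y, hy, rfl⟩
          ⟨z, hz, h1⟩
        exact ⟨l, by rw [hl]⟩
      · have h1 := eq_vertex_of_contr_eq hq hij (wordMap_mem_gasket u hy)
          (wordMap_mem_gasket w hz) hzy.symm
        exact ⟨j, by rw [wordMap_vertex_of_mem_cell hq ⟨y, hy, h1⟩, h1]⟩

theorem exists_vertex_of_mem_cell_of_not_prefix (hq : ∀ i j, i ≠ j → dist (q i) (q j) = 1)
    {u w : List (Fin (n + 1))} (hl : u.length ≤ w.length) (hne : ¬ u <+: w)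
    {x : EuclideanSpace ℝ (Fin n)} (hu : x ∈ cell q u) (hw : x ∈ cell q w) :
    ∃ l, x = wordMap q u (q l) := by
  refine exists_vertex_of_mem_cells hq (w := w.take u.length) (by simp [hl]) (fun h => hne ?_) hu ?_
  · rw [h]
    exact List.take_prefix _ _
  · rw [← List.take_append_drop u.length w] at hw
    exact cell_append_subset _ _ hw

theorem cell_subset_of_prefix {u w : List (Fin (n + 1))} (h : u <+: w) : cell q w ⊆ cell q u := by
  obtain ⟨v, rfl⟩ := h
  exact cell_append_subset u v

theorem not_disjoint_cell_of_prefix {u w : List (Fin (n + 1))} (h : u <+: w) :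
    ¬ Disjoint (cell q u) (cell q w) := fun hd =>
  (disjoint_left.1 hd) (cell_subset_of_prefix h (wordMap_vertex_mem_cell w 0))
    (wordMap_vertex_mem_cell w 0)

/-! ### Curves of bounded length in the gasket -/

/-- The point `y` is reached from `x` by a curve of speed at most one in the gasket at time `L`. -/
def ReachableIn {n : ℕ} (q : Fin (n + 1) → EuclideanSpace ℝ (Fin n))
    (x y : EuclideanSpace ℝ (Fin n)) (L : ℝ) : Prop :=
  0 ≤ L ∧ ∃ g : ℝ → EuclideanSpace ℝ (Fin n), LipschitzWith 1 g ∧ (∀ s, g s ∈ gasket q) ∧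
    g 0 = x ∧ g L = y

theorem ReachableIn.refl {x : EuclideanSpace ℝ (Fin n)} (hx : x ∈ gasket q) :
    ReachableIn q x x 0 :=
  ⟨le_rfl, fun _ => x, LipschitzWith.of_dist_le_mul (by simp), fun _ => hx, rfl, rfl⟩

theorem ReachableIn.symm {x y : EuclideanSpace ℝ (Fin n)} {L : ℝ} (h : ReachableIn q x y L) :
    ReachableIn q y x L := by
  obtain ⟨hL, g, hg, hgm, h0, h1⟩ := h
  refine ⟨hL, fun s => g (L - s), LipschitzWith.of_dist_le_mul fun s s' => ?_,
    fun s => hgm _, by simpa using h1, by simpa using h0⟩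
  have := hg.dist_le_mul (L - s) (L - s')
  rwa [dist_sub_left] at this

theorem ReachableIn.mem_gasket {x y : EuclideanSpace ℝ (Fin n)} {L : ℝ}
    (h : ReachableIn q x y L) : y ∈ gasket q := by
  obtain ⟨-, g, -, hgm, -, rfl⟩ := h
  exact hgm L

theorem ReachableIn.dist_le {x y : EuclideanSpace ℝ (Fin n)} {L : ℝ}
    (h : ReachableIn q x y L) : dist x y ≤ L := by
  obtain ⟨hL, g, hg, -, rfl, rfl⟩ := h
  have := hg.dist_le_mul 0 L
  rwa [NNReal.coe_one, one_mul, Real.dist_eq, zero_sub, abs_neg, abs_of_nonneg hL] at this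

theorem ReachableIn.trans {x y z : EuclideanSpace ℝ (Fin n)} {L M : ℝ}
    (h : ReachableIn q x y L) (h' : ReachableIn q y z M) : ReachableIn q x z (L + M) := by
  obtain ⟨hL, g, hg, hgm, h0, h1⟩ := h
  obtain ⟨hM, g', hg', hgm', h0', h1'⟩ := h'
  -- At each time one of the two curves rests at `y`, which the subtraction removes. The two clipped
  -- time differences add up to `dist s s'`, so the speed stays at most one.
  refine ⟨by positivity, fun s => g (min s L) + g' (max (s - L) 0) - y,
    LipschitzWith.of_dist_le_mul fun s s' => ?_, fun s => ?_, ?_, ?_⟩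
  · have e1 := hg.dist_le_mul (min s L) (min s' L)
    have e2 := hg'.dist_le_mul (max (s - L) 0) (max (s' - L) 0)
    have e3 : dist (min s L) (min s' L) + dist (max (s - L) 0) (max (s' - L) 0) = dist s s' := by
      simp only [Real.dist_eq]
      rcases le_total s L with h | h <;> rcases le_total s' L with h' | h'
      · simp [h, h']
      · simp only [h, h', min_eq_left, min_eq_right, max_eq_right (sub_nonpos.2 h),
          max_eq_left (sub_nonneg.2 h')]
        rw [abs_of_nonpos (by linarith), abs_of_nonpos (by linarith), abs_of_nonpos (by linarith)]
        ring
      · simp only [h, h', min_eq_left, min_eq_right, max_eq_right (sub_nonpos.2 h'),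
          max_eq_left (sub_nonneg.2 h)]
        rw [abs_of_nonneg (by linarith), abs_of_nonneg (by linarith), abs_of_nonneg (by linarith)]
        ring
      · simp [h, h']
    rw [dist_sub_right]
    refine (dist_add_add_le _ _ _ _).trans ?_
    rw [NNReal.coe_one, one_mul] at *
    linarith
  · rcases le_total s L with h | h
    · simp only [min_eq_left h]
      rw [max_eq_right (sub_nonpos.2 h), h0', add_sub_cancel_right]
      exact hgm s
    · simp only [min_eq_right h]
      rw [h1, add_sub_cancel_left]
      exact hgm' _
  · simp [hL, h0, h0']
  · simp [hM, h1, h1']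

theorem ReachableIn.map_contr {x y : EuclideanSpace ℝ (Fin n)} {L : ℝ} (i : Fin (n + 1))
    (h : ReachableIn q x y L) :
    ReachableIn q (contr q i x) (contr q i y) (L / 2) := by
  obtain ⟨hL, g, hg, hgm, rfl, rfl⟩ := h
  refine ⟨by positivity, fun s => contr q i (g (2 * s)),
    LipschitzWith.of_dist_le_mul fun s s' => ?_, fun s => contr_mem_gasket i (hgm _), by simp,
    by simp [mul_div_cancel₀]⟩
  have := hg.dist_le_mul (2 * s) (2 * s')
  rw [NNReal.coe_one, one_mul, Real.dist_eq, ← mul_sub, abs_mul, abs_two] at this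
  rw [dist_contr, NNReal.coe_one, one_mul, Real.dist_eq]
  linarith

theorem ReachableIn.map_wordMap {x y : EuclideanSpace ℝ (Fin n)} {L : ℝ} (w : List (Fin (n + 1)))
    (h : ReachableIn q x y L) :
    ReachableIn q (wordMap q w x) (wordMap q w y) ((1 / 2) ^ w.length * L) := by
  induction w with
  | nil => simpa [wordMap] using h
  | cons i w ih =>
    have := ih.map_contr i
    have e : (1 / 2 : ℝ) ^ w.length * L / 2 = (1 / 2) ^ (i :: w).length * L := by
      rw [List.length_cons, pow_succ]
      ring
    rwa [e] at this

theorem ReachableIn.mono {x y : EuclideanSpace ℝ (Fin n)} {L M : ℝ}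
    (h : ReachableIn q x y L) (hLM : L ≤ M) : ReachableIn q x y M := by
  have h1 : ReachableIn q y y (M - L) :=
    ⟨sub_nonneg.2 hLM, fun _ => y, LipschitzWith.of_dist_le_mul (by simp),
      fun _ => h.mem_gasket, rfl, rfl⟩
  simpa using h.trans h1

/-- Reachability is preserved under limits. -/
theorem ReachableIn.of_tendsto {x y : ℕ → EuclideanSpace ℝ (Fin n)} {L : ℕ → ℝ}
    {x₀ y₀ : EuclideanSpace ℝ (Fin n)} {L₀ : ℝ} (h : ∀ m, ReachableIn q (x m) (y m) (L m))
    (hx : Filter.Tendsto x Filter.atTop (𝓝 x₀)) (hy : Filter.Tendsto y Filter.atTop (𝓝 y₀))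
    (hL : Filter.Tendsto L Filter.atTop (𝓝 L₀)) : ReachableIn q x₀ y₀ L₀ := by
  choose hL0 g hg hgm h0 h1 using h
  -- Pointwise limits along an ultrafilter, which exist by compactness of the gasket, play the role
  -- of the Arzelà–Ascoli theorem.
  set U : Ultrafilter ℕ := Filter.hyperfilter ℕ
  have hU : (U : Filter ℕ) ≤ Filter.atTop := by
    rw [← Nat.cofinite_eq_atTop]
    exact Filter.hyperfilter_le_cofinite
  have hlim : ∀ s, ∃ z ∈ gasket q, Filter.Tendsto (fun m => g m s) U (𝓝 z) := by
    intro s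
    obtain ⟨z, hz, hzl⟩ := (isCompact_gasket q).ultrafilter_le_nhds (U.map fun m => g m s)
      (Filter.le_principal_iff.2 (Filter.Eventually.of_forall (f := (U : Filter ℕ))
        fun m => hgm m s))
    exact ⟨z, hz, hzl⟩
  choose G hGm hG using hlim
  refine ⟨ge_of_tendsto' hL hL0, G, LipschitzWith.of_dist_le_mul fun s s' => ?_, hGm, ?_, ?_⟩
  · exact le_of_tendsto' ((hG s).dist (hG s')) fun m => (hg m).dist_le_mul s s'
  · refine tendsto_nhds_unique (hG 0) ?_
    simp only [h0]
    exact hx.mono_left hU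
  · refine tendsto_nhds_unique (hG L₀) ?_
    refine (tendsto_iff_of_dist ?_).1 (hy.mono_left hU)
    refine squeeze_zero (fun _ => dist_nonneg) (g := fun m => dist (L m) L₀) (fun m => ?_) ?_
    · rw [← h1 m]
      simpa using (hg m).dist_le_mul (L m) L₀
    · exact (tendsto_iff_dist_tendsto_zero.1 hL).mono_left hU

/-! ### Edges -/

theorem dist_combination (x y : EuclideanSpace ℝ (Fin n)) (c d : ℝ) :
    dist ((1 - c) • x + c • y) ((1 - d) • x + d • y) = |c - d| * dist x y := by
  have : ((1 - c) • x + c • y) - ((1 - d) • x + d • y) = (d - c) • (x - y) := by module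
  rw [dist_eq_norm, this, norm_smul, Real.norm_eq_abs, abs_sub_comm, dist_eq_norm]

/-- The segment is the union of its images under `F_i` and `F_j`. Halving it `N` times puts each of
its points within `2^(-N)` of the gasket, which is closed. -/
theorem combination_mem_gasket (hq : ∀ i j, i ≠ j → dist (q i) (q j) = 1) (i j : Fin (n + 1))
    {c : ℝ} (hc : c ∈ Icc (0 : ℝ) 1) : (1 - c) • q i + c • q j ∈ gasket q := by
  have key : ∀ N : ℕ, ∀ c ∈ Icc (0 : ℝ) 1,
      ∃ s ∈ gasket q, dist ((1 - c) • q i + c • q j) s ≤ (1 / 2 : ℝ) ^ N := by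
    intro N
    induction N with
    | zero =>
      intro c hc
      refine ⟨q i, vertex_mem_gasket i, ?_⟩
      have := dist_combination (q i) (q j) c 0
      simp only [sub_zero, one_smul, zero_smul, add_zero] at this
      rw [this, abs_of_nonneg hc.1, pow_zero]
      have := dist_vertex_le_one hq j (vertex_mem_gasket i)
      nlinarith [hc.1, hc.2, dist_nonneg (x := q i) (y := q j)]
    | succ N ih =>
      intro c hc
      rcases le_total c (1 / 2) with h | h
      · obtain ⟨s, hs, hd⟩ := ih (2 * c) ⟨by linarith [hc.1], by linarith⟩
        refine ⟨contr q i s, contr_mem_gasket i hs, ?_⟩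
        have e : (1 - c) • q i + c • q j = contr q i ((1 - 2 * c) • q i + (2 * c) • q j) := by
          unfold contr
          module
        rw [e, dist_contr, pow_succ]
        linarith
      · obtain ⟨s, hs, hd⟩ := ih (2 * c - 1) ⟨by linarith, by linarith [hc.2]⟩
        refine ⟨contr q j s, contr_mem_gasket j hs, ?_⟩
        have e : (1 - c) • q i + c • q j =
            contr q j ((1 - (2 * c - 1)) • q i + (2 * c - 1) • q j) := by
          unfold contr
          module
        rw [e, dist_contr, pow_succ]
        linarith
  rw [← (isCompact_gasket q).isClosed.closure_eq, Metric.mem_closure_iff]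
  intro ε hε
  obtain ⟨N, hN⟩ := exists_pow_lt_of_lt_one hε (by norm_num : (1 / 2 : ℝ) < 1)
  obtain ⟨s, hs, hd⟩ := key N c hc
  exact ⟨s, hs, hd.trans_lt hN⟩

theorem reachableIn_combination (hq : ∀ i j, i ≠ j → dist (q i) (q j) = 1) (i j : Fin (n + 1))
    {c d : ℝ} (hc : c ∈ Icc (0 : ℝ) 1) (hd : d ∈ Icc (0 : ℝ) 1) :
    ReachableIn q ((1 - c) • q i + c • q j) ((1 - d) • q i + d • q j) |c - d| := by
  wlog hcd : c ≤ d generalizing c d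
  · rw [abs_sub_comm]
    exact (this hd hc (le_of_not_ge hcd)).symm
  have hmem : ∀ s : ℝ, min (max (c + s) 0) 1 ∈ Icc (0 : ℝ) 1 := fun s =>
    ⟨le_min (le_max_right _ _) zero_le_one, min_le_right _ _⟩
  refine ⟨abs_nonneg _,
    fun s => (1 - min (max (c + s) 0) 1) • q i + (min (max (c + s) 0) 1) • q j,
    LipschitzWith.of_dist_le_mul fun s s' => ?_,
    fun s => combination_mem_gasket hq i j (hmem s), ?_, ?_⟩
  · rw [dist_combination, NNReal.coe_one, one_mul, Real.dist_eq]
    have h1 := dist_vertex_le_one hq j (vertex_mem_gasket i)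
    have h2 : |min (max (c + s) 0) 1 - min (max (c + s') 0) 1| ≤ |s - s'| := by
      refine (abs_min_sub_min_le_max _ _ _ _).trans (max_le ?_ (by simp))
      refine (abs_max_sub_max_le_max _ _ _ _).trans (max_le ?_ (by simp))
      rw [add_sub_add_left_eq_sub]
    calc _ ≤ |min (max (c + s) 0) 1 - min (max (c + s') 0) 1| * 1 := by gcongr
      _ ≤ _ := by rwa [mul_one]
  · simp [hc.1, hc.2]
  · have : c + |c - d| = d := by rw [abs_of_nonpos (by linarith)]; ring
    simp only [this, max_eq_left hd.1, min_eq_left hd.2]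

/-- Every point is joined to every vertex by a curve that climbs at unit speed in the
corresponding barycentric coordinate. -/
theorem reachableIn_vertex (hq : ∀ i j, i ≠ j → dist (q i) (q j) = 1) (l : Fin (n + 1))
    {x : EuclideanSpace ℝ (Fin n)} (hx : x ∈ gasket q) :
    ReachableIn q x (q l) (1 - bary q l x) := by
  have hw : ∀ w : List (Fin (n + 1)),
      ReachableIn q (wordMap q w (q l)) (q l) (1 - bary q l (wordMap q w (q l))) := by
    intro w
    induction w with
    | nil =>
      simpa [wordMap, bary_vertex hq] using ReachableIn.refl (vertex_mem_gasket l)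
    | cons i w ih =>
      have h1 := ih.map_contr i
      -- `F_i` carries the curve to `q l` to a curve ending at `F_i (q l)`, the midpoint of the edge
      -- from `q i` to `q l`; the remaining half edge has length `1/2`, or `0` if `i = l`.
      have h2 : ReachableIn q (contr q i (q l)) (q l) (1 / 2 - if i = l then (1 / 2 : ℝ) else 0) := by
        split_ifs with hil
        · subst hil
          rw [contr_vertex, sub_self]
          exact ReachableIn.refl (vertex_mem_gasket i)
        · have := reachableIn_combination hq i l (c := 1 / 2) (d := 1) (by norm_num) (by norm_num)
          have e : (1 - (1 / 2 : ℝ)) • q i + (1 / 2 : ℝ) • q l = contr q i (q l) := by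
            unfold contr
            module
          rw [e] at this
          norm_num at this ⊢
          exact this
      have h3 := h1.trans h2
      simp only [wordMap, Function.comp, bary_contr hq]
      convert h3 using 1
      split_ifs <;> ring
  choose w hwl y hy hxy using fun N => exists_cell_of_mem_gasket N hx
  have hlim : Filter.Tendsto (fun N => wordMap q (w N) (q l)) Filter.atTop (𝓝 x) := by
    rw [tendsto_iff_dist_tendsto_zero]
    refine squeeze_zero (fun _ => dist_nonneg) (g := fun N => (1 / 2 : ℝ) ^ N) (fun N => ?_)
      (tendsto_pow_atTop_nhds_zero_of_lt_one (by norm_num) (by norm_num))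
    conv_lhs => rw [← hxy N]
    rw [dist_wordMap, hwl, dist_comm]
    exact mul_le_of_le_one_right (by positivity) (dist_vertex_le_one hq l (hy N))
  exact ReachableIn.of_tendsto (fun N => hw (w N)) hlim tendsto_const_nhds
    (((continuous_bary l).tendsto x).comp hlim |>.const_sub 1)

/-- The bound `1 + 2^(-N)` improves with `N`: points in different subcells are joined through the
common midpoint in time at most one, and for points in the same subcell the previous bound is
halved. -/
theorem reachableIn_one (hq : ∀ i j, i ≠ j → dist (q i) (q j) = 1)
    {x y : EuclideanSpace ℝ (Fin n)} (hx : x ∈ gasket q) (hy : y ∈ gasket q) :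
    ReachableIn q x y 1 := by
  have key : ∀ N : ℕ, ∀ x ∈ gasket q, ∀ y ∈ gasket q, ReachableIn q x y (1 + (1 / 2 : ℝ) ^ N) := by
    intro N
    induction N with
    | zero =>
      intro x hx y hy
      have h1 := (reachableIn_vertex hq 0 hx).trans (reachableIn_vertex hq 0 hy).symm
      refine h1.mono ?_
      have := bary_nonneg hq 0 hx
      have := bary_nonneg hq 0 hy
      norm_num
      linarith
    | succ N ih =>
      intro x hx y hy
      obtain ⟨i, x', hx', rfl⟩ := exists_contr_of_mem_gasket hx
      obtain ⟨j, y', hy', rfl⟩ := exists_contr_of_mem_gasket hy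
      rcases eq_or_ne i j with rfl | hij
      · refine ((ih x' hx' y' hy').map_contr i).mono ?_
        rw [pow_succ]
        linarith
      · have h1 := ((reachableIn_vertex hq j hx').map_contr i)
        have h2 := ((reachableIn_vertex hq i hy').map_contr j).symm
        rw [contr_vertex_comm] at h2
        rw [contr_vertex_comm] at h1
        rw [contr_vertex_comm] at h2
        refine (h1.trans h2).mono ?_
        have := bary_nonneg hq j hx'
        have := bary_nonneg hq i hy'
        have : (0 : ℝ) < (1 / 2) ^ (N + 1) := by positivity
        linarith
  refine ReachableIn.of_tendsto (fun N => key N x hx y hy) tendsto_const_nhds tendsto_const_nhds ?_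
  simpa using (tendsto_pow_atTop_nhds_zero_of_lt_one (by norm_num : (0 : ℝ) ≤ 1 / 2)
    (by norm_num)).const_add 1

/-! ### The arc length distance -/

/-- The smallest time in which `y` can be reached from `x` at speed at most one. -/
def arcDist {n : ℕ} (q : Fin (n + 1) → EuclideanSpace ℝ (Fin n))
    (x y : EuclideanSpace ℝ (Fin n)) : ℝ :=
  sInf {L | ReachableIn q x y L}

theorem bddBelow_reachableIn (x y : EuclideanSpace ℝ (Fin n)) :
    BddBelow {L | ReachableIn q x y L} :=
  ⟨0, fun _ h => h.1⟩

theorem ReachableIn.arcDist_le {x y : EuclideanSpace ℝ (Fin n)} {L : ℝ}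
    (h : ReachableIn q x y L) : arcDist q x y ≤ L :=
  csInf_le (bddBelow_reachableIn x y) h

theorem arcDist_nonneg (x y : EuclideanSpace ℝ (Fin n)) : 0 ≤ arcDist q x y :=
  Real.sInf_nonneg fun _ h => h.1

theorem arcDist_comm (x y : EuclideanSpace ℝ (Fin n)) : arcDist q x y = arcDist q y x := by
  unfold arcDist
  congr 1
  ext L
  exact ⟨ReachableIn.symm, ReachableIn.symm⟩

/-- The infimum is attained because reachability is closed under limits; by `reachableIn_one` it is
not the infimum of the empty set. -/
theorem reachableIn_arcDist (hq : ∀ i j, i ≠ j → dist (q i) (q j) = 1)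
    {x y : EuclideanSpace ℝ (Fin n)} (hx : x ∈ gasket q) (hy : y ∈ gasket q) :
    ReachableIn q x y (arcDist q x y) := by
  obtain ⟨L, -, hL, hLm⟩ := exists_seq_tendsto_sInf ⟨1, reachableIn_one hq hx hy⟩
    (bddBelow_reachableIn (q := q) x y)
  exact ReachableIn.of_tendsto hLm tendsto_const_nhds tendsto_const_nhds hL

theorem arcDist_triangle (hq : ∀ i j, i ≠ j → dist (q i) (q j) = 1)
    {x y z : EuclideanSpace ℝ (Fin n)} (hx : x ∈ gasket q) (hy : y ∈ gasket q)
    (hz : z ∈ gasket q) : arcDist q x z ≤ arcDist q x y + arcDist q y z :=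
  ((reachableIn_arcDist hq hx hy).trans (reachableIn_arcDist hq hy hz)).arcDist_le

theorem arcDist_self {x : EuclideanSpace ℝ (Fin n)} (hx : x ∈ gasket q) : arcDist q x x = 0 :=
  le_antisymm (ReachableIn.refl hx).arcDist_le (arcDist_nonneg x x)

theorem dist_le_arcDist (hq : ∀ i j, i ≠ j → dist (q i) (q j) = 1)
    {x y : EuclideanSpace ℝ (Fin n)} (hx : x ∈ gasket q) (hy : y ∈ gasket q) :
    dist x y ≤ arcDist q x y :=
  (reachableIn_arcDist hq hx hy).dist_le

theorem arcDist_le_of_mem_cell (hq : ∀ i j, i ≠ j → dist (q i) (q j) = 1)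
    {w : List (Fin (n + 1))} {x y : EuclideanSpace ℝ (Fin n)} (hx : x ∈ cell q w)
    (hy : y ∈ cell q w) : arcDist q x y ≤ (1 / 2) ^ w.length := by
  obtain ⟨x, hx, rfl⟩ := hx
  obtain ⟨y, hy, rfl⟩ := hy
  simpa using ((reachableIn_one hq hx hy).map_wordMap w).arcDist_le

theorem abs_arcDist_sub_le (hq : ∀ i j, i ≠ j → dist (q i) (q j) = 1)
    {x y z : EuclideanSpace ℝ (Fin n)} (hx : x ∈ gasket q) (hy : y ∈ gasket q)
    (hz : z ∈ gasket q) : |arcDist q x y - arcDist q x z| ≤ arcDist q y z := by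
  have h1 := arcDist_triangle hq hx hy hz
  have h2 := arcDist_triangle hq hx hz hy
  rw [arcDist_comm z y] at h2
  rw [abs_le]
  constructor <;> linarith

/-- The finitely many cells of generation `N` that avoid `y` form a closed set. Points of the gasket
near `y` lie outside it and therefore share a cell with `y`. -/
theorem continuousOn_arcDist (hq : ∀ i j, i ≠ j → dist (q i) (q j) = 1)
    {x : EuclideanSpace ℝ (Fin n)} (hx : x ∈ gasket q) :
    ContinuousOn (arcDist q x) (gasket q) := by
  intro y hy
  rw [Metric.continuousWithinAt_iff']
  intro ε hε
  obtain ⟨N, hN⟩ := exists_pow_lt_of_lt_one hε (by norm_num : (1 / 2 : ℝ) < 1)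
  set T : Set (EuclideanSpace ℝ (Fin n)) :=
    ⋃ w ∈ {w : List (Fin (n + 1)) | w.length = N ∧ y ∉ cell q w}, cell q w with hTdef
  have hT : IsClosed T := by
    refine Set.Finite.isClosed_biUnion ((List.finite_length_eq (Fin (n + 1)) N).subset
      fun w hw => hw.1) fun w _ => (isCompact_cell w).isClosed
  have hyT : y ∉ T := by
    simp only [hTdef, mem_iUnion, not_exists]
    exact fun w hw => hw.2
  filter_upwards [mem_nhdsWithin_of_mem_nhds (hT.isOpen_compl.mem_nhds hyT), self_mem_nhdsWithin]
    with z hzT hz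
  obtain ⟨w, hw, hzw⟩ := exists_cell_of_mem_gasket N hz
  have hyw : y ∈ cell q w := by
    by_contra hyw
    exact hzT (mem_biUnion (⟨hw, hyw⟩ : w ∈ {w : List (Fin (n + 1)) | w.length = N ∧ y ∉ cell q w})
      hzw)
  have h1 := abs_arcDist_sub_le hq hx hz hy
  have h2 := arcDist_le_of_mem_cell hq hzw hyw
  rw [hw] at h2
  rw [Real.dist_eq]
  linarith

/-! ### Lower bounds for the length of connected sets -/

/-- Being 1-Lipschitz piece by piece suffices, since the pieces can be made disjoint and `H¹` adds
over them. The set `E` is arbitrary, so additivity is applied to the restriction of `H¹` to `E`. -/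
theorem volume_image_le_of_cover {ι X : Type*} [Countable ι] [MetricSpace X] [MeasurableSpace X]
    [BorelSpace X] {f : X → ℝ} {T : ι → Set X} (hT : ∀ i, MeasurableSet (T i)) {E : Set X}
    (hE : E ⊆ ⋃ i, T i) (hf : ∀ i, LipschitzOnWith 1 f (E ∩ T i)) :
    volume (f '' E) ≤ Measure.hausdorffMeasure 1 E := by
  rcases isEmpty_or_nonempty ι with hι | hι
  · rw [iUnion_of_empty, subset_empty_iff] at hE
    simp [hE]
  obtain ⟨e, he⟩ := exists_surjective_nat ι
  set D : ℕ → Set X := disjointed (T ∘ e) with hD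
  have hDm : ∀ k, MeasurableSet (D k) := MeasurableSet.disjointed fun k => hT _
  have hDT : ∀ k, D k ⊆ T (e k) := fun k => disjointed_subset (T ∘ e) k
  have hU : E ⊆ ⋃ k, D k := by
    rw [hD, iUnion_disjointed]
    refine hE.trans (iUnion_subset fun i => ?_)
    obtain ⟨k, rfl⟩ := he i
    exact subset_iUnion (T ∘ e) k
  have h1 : f '' E ⊆ ⋃ k, f '' (E ∩ D k) := by
    rw [← image_iUnion, ← inter_iUnion, inter_eq_left.2 hU]
  calc volume (f '' E) ≤ ∑' k, volume (f '' (E ∩ D k)) :=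
        (measure_mono h1).trans (measure_iUnion_le _)
    _ ≤ ∑' k, Measure.hausdorffMeasure 1 (E ∩ D k) := by
        refine ENNReal.tsum_le_tsum fun k => ?_
        rw [← hausdorffMeasure_real]
        have := ((hf (e k)).mono (inter_subset_inter_right E (hDT k))).hausdorffMeasure_image_le
          zero_le_one
        simpa using this
    _ = ∑' k, (Measure.hausdorffMeasure 1).restrict E (D k) := by
        refine tsum_congr fun k => ?_
        rw [Measure.restrict_apply (hDm k), inter_comm]
    _ = (Measure.hausdorffMeasure 1).restrict E (⋃ k, D k) :=
        (measure_iUnion (disjoint_disjointed _) hDm).symm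
    _ ≤ (Measure.hausdorffMeasure 1).restrict E univ := measure_mono (subset_univ _)
    _ = Measure.hausdorffMeasure 1 E := Measure.restrict_apply_univ _

/-- A function whose oscillation on every small cell is at most the size of the cell is
uniformly approximated by functions that are `1`-Lipschitz on every cell of a generation. -/
theorem exists_lipschitzOnWith_cells (hq : ∀ i j, i ≠ j → dist (q i) (q j) = 1)
    {f : EuclideanSpace ℝ (Fin n) → ℝ} {N : ℕ}
    (hf : ∀ w : List (Fin (n + 1)), w.length = N → ∀ x ∈ cell q w, ∀ y ∈ cell q w,
      |f x - f y| ≤ (1 / 2 : ℝ) ^ N) :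
    ∃ g : EuclideanSpace ℝ (Fin n) → ℝ,
      (∀ w : List (Fin (n + 1)), w.length = N → LipschitzOnWith 1 g (cell q w)) ∧
      ∀ x ∈ gasket q, |g x - f x| ≤ 2 * (1 / 2 : ℝ) ^ N := by
  classical
  have hext : ∀ w : List (Fin (n + 1)), ∃ g : EuclideanSpace ℝ (Fin n) → ℝ,
      w.length = N → LipschitzWith 1 g ∧ ∀ l, f (wordMap q w (q l)) = g (wordMap q w (q l)) := by
    intro w
    by_cases hw : w.length = N
    -- Distinct corners of a cell of generation `N` are at Euclidean distance exactly `2^(-N)`, so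
    -- the oscillation bound makes `f` 1-Lipschitz on the corners, and it extends from there.
    · have : LipschitzOnWith 1 f (range fun l => wordMap q w (q l)) := by
        refine LipschitzOnWith.of_dist_le_mul ?_
        rintro _ ⟨l, rfl⟩ _ ⟨m, rfl⟩
        rcases eq_or_ne l m with rfl | hlm
        · simp
        · simp only [dist_wordMap, hq l m hlm, hw, Real.dist_eq, NNReal.coe_one, one_mul, mul_one]
          exact hf w hw _ (wordMap_vertex_mem_cell w l) _ (wordMap_vertex_mem_cell w m)
      obtain ⟨g, hg, hgf⟩ := this.extend_real
      exact ⟨g, fun _ => ⟨hg, fun l => hgf (mem_range_self l)⟩⟩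
    · exact ⟨f, fun h => absurd h hw⟩
  choose g hg using hext
  choose! W hWl hW using fun (x : EuclideanSpace ℝ (Fin n)) (hx : x ∈ gasket q) =>
    exists_cell_of_mem_gasket N hx
  -- The extensions fit together: different cells of generation `N` share only corners, where all
  -- extensions agree with `f`.
  have hglue : ∀ w : List (Fin (n + 1)), w.length = N → ∀ x ∈ cell q w, g (W x) x = g w x := by
    intro w hw x hx
    have hxS := cell_subset_gasket w hx
    by_cases h : w = W x
    · rw [← h]
    obtain ⟨l, hl⟩ := exists_vertex_of_mem_cells hq (hw.trans (hWl x hxS).symm) h hx (hW x hxS)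
    obtain ⟨m, hm⟩ := exists_vertex_of_mem_cells hq ((hWl x hxS).trans hw.symm) (Ne.symm h)
      (hW x hxS) hx
    have e1 := (hg w hw).2 l
    have e2 := (hg (W x) (hWl x hxS)).2 m
    rw [← hl] at e1
    rw [← hm] at e2
    rw [← e1, ← e2]
  refine ⟨fun x => g (W x) x, fun w hw => ?_, fun x hx => ?_⟩
  · refine LipschitzOnWith.of_dist_le_mul fun x hx y hy => ?_
    simp only [hglue w hw x hx, hglue w hw y hy]
    exact (hg w hw).1.dist_le_mul x y
  · have hw := hWl x hx
    obtain ⟨y, hy, hyx⟩ := hW x hx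
    have e1 := (hg (W x) hw).2 0
    have e2 := (hg (W x) hw).1.dist_le_mul x (wordMap q (W x) (q 0))
    have e3 := hf (W x) hw x (hW x hx) _ (wordMap_vertex_mem_cell _ 0)
    have e4 : dist x (wordMap q (W x) (q 0)) ≤ (1 / 2 : ℝ) ^ N := by
      have e5 := dist_wordMap (q := q) (W x) y (q 0)
      rw [hyx, hw] at e5
      rw [e5]
      exact mul_le_of_le_one_right (by positivity) (dist_vertex_le_one hq 0 hy)
    rw [NNReal.coe_one, one_mul, Real.dist_eq] at e2
    rw [e1] at e3
    rw [abs_le] at e2 e3 ⊢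
    constructor <;> linarith

/-- The image of `K` under the approximation `g` is connected, so it contains the interval between
`g x` and `g y`, and its length is at most `H¹(K)`. Replacing `f` by `g` costs at most `4 * 2^(-N)`,
which tends to zero. Since only fine generations matter, the oscillation need be controlled only
from `N₀` on. -/
theorem ofReal_abs_sub_le_hausdorffMeasure (hq : ∀ i j, i ≠ j → dist (q i) (q j) = 1)
    {f : EuclideanSpace ℝ (Fin n) → ℝ} {N₀ : ℕ}
    (hf : ∀ w : List (Fin (n + 1)), N₀ ≤ w.length → ∀ x ∈ cell q w, ∀ y ∈ cell q w,
      |f x - f y| ≤ (1 / 2 : ℝ) ^ w.length)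
    {K : Set (EuclideanSpace ℝ (Fin n))} (hK : IsPreconnected K) (hKS : K ⊆ gasket q)
    {x y : EuclideanSpace ℝ (Fin n)} (hx : x ∈ K) (hy : y ∈ K) :
    ENNReal.ofReal |f x - f y| ≤ Measure.hausdorffMeasure 1 K := by
  have key : ∀ N, N₀ ≤ N → ENNReal.ofReal (|f x - f y| - 4 * (1 / 2 : ℝ) ^ N) ≤
      Measure.hausdorffMeasure 1 K := by
    intro N hN
    obtain ⟨g, hg, hgf⟩ := exists_lipschitzOnWith_cells hq (f := f) (N := N) fun w hw x hx y hy => by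
      rw [← hw]
      exact hf w (hw ▸ hN) x hx y hy
    have : Finite {w : List (Fin (n + 1)) // w.length = N} :=
      (List.finite_length_eq (Fin (n + 1)) N).to_subtype
    have hcov : gasket q ⊆ ⋃ w : {w : List (Fin (n + 1)) // w.length = N}, cell q w.1 := by
      intro z hz
      obtain ⟨w, hw, hzw⟩ := exists_cell_of_mem_gasket N hz
      exact mem_iUnion.2 ⟨⟨w, hw⟩, hzw⟩
    have hcont : ContinuousOn g (gasket q) :=
      ((locallyFinite_of_finite fun w : {w : List (Fin (n + 1)) // w.length = N} =>
        cell q w.1).continuousOn_iUnion (fun w => (isCompact_cell w.1).isClosed)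
        fun w => (hg w.1 w.2).continuousOn).mono hcov
    have hvol := volume_image_le_of_cover (f := g) (E := K)
      (T := fun w : {w : List (Fin (n + 1)) // w.length = N} => cell q w.1)
      (fun w => (isCompact_cell w.1).measurableSet) (hKS.trans hcov)
      fun w => (hg w.1 w.2).mono inter_subset_right
    have hconn : IsPreconnected (g '' K) := hK.image g (hcont.mono hKS)
    have hsub : uIcc (g y) (g x) ⊆ g '' K :=
      hconn.ordConnected.uIcc_subset (mem_image_of_mem g hy) (mem_image_of_mem g hx)
    have h1 := (measure_mono hsub).trans hvol
    rw [Real.volume_interval] at h1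
    refine (ENNReal.ofReal_le_ofReal ?_).trans h1
    have e1 := abs_le.1 (hgf x (hKS hx))
    have e2 := abs_le.1 (hgf y (hKS hy))
    rcases abs_cases (f x - f y) with h | h <;> rcases abs_cases (g x - g y) with h' | h' <;>
      linarith
  refine le_of_tendsto (x := Filter.atTop) (f := fun N : ℕ =>
    ENNReal.ofReal (|f x - f y| - 4 * (1 / 2 : ℝ) ^ N)) ?_ ?_
  · refine (ENNReal.continuous_ofReal.tendsto _).comp ?_
    simpa using ((tendsto_pow_atTop_nhds_zero_of_lt_one (by norm_num : (0 : ℝ) ≤ 1 / 2)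
      (by norm_num)).const_mul 4).const_sub |f x - f y|
  · filter_upwards [Filter.eventually_ge_atTop N₀] with N hN using key N hN

theorem abs_arcDist_sub_le_of_mem_cell (hq : ∀ i j, i ≠ j → dist (q i) (q j) = 1)
    {x : EuclideanSpace ℝ (Fin n)} (hx : x ∈ gasket q) (w : List (Fin (n + 1)))
    {y z : EuclideanSpace ℝ (Fin n)} (hy : y ∈ cell q w) (hz : z ∈ cell q w) :
    |arcDist q x y - arcDist q x z| ≤ (1 / 2 : ℝ) ^ w.length :=
  (abs_arcDist_sub_le hq hx (cell_subset_gasket w hy) (cell_subset_gasket w hz)).trans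
    (arcDist_le_of_mem_cell hq hy hz)

theorem ofReal_arcDist_le_hausdorffMeasure (hq : ∀ i j, i ≠ j → dist (q i) (q j) = 1)
    {K : Set (EuclideanSpace ℝ (Fin n))} (hK : IsPreconnected K) (hKS : K ⊆ gasket q)
    {x y : EuclideanSpace ℝ (Fin n)} (hx : x ∈ K) (hy : y ∈ K) :
    ENNReal.ofReal (arcDist q x y) ≤ Measure.hausdorffMeasure 1 K := by
  have := ofReal_abs_sub_le_hausdorffMeasure hq (f := arcDist q x) (N₀ := 0)
    (fun w _ y hy z hz => abs_arcDist_sub_le_of_mem_cell hq (hKS hx) w hy hz) hK hKS hx hy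
  rwa [arcDist_self (hKS hx), zero_sub, abs_neg, abs_of_nonneg (arcDist_nonneg x y)] at this

/-- The image of `[0, L]` under a curve of speed at most one has length at most `L`. -/
theorem hausdorffMeasure_image_Icc_le {g : ℝ → EuclideanSpace ℝ (Fin n)} (hg : LipschitzWith 1 g)
    (a b : ℝ) : Measure.hausdorffMeasure 1 (g '' Icc a b) ≤ ENNReal.ofReal (b - a) := by
  have := hg.hausdorffMeasure_image_le zero_le_one (Icc a b)
  rwa [hausdorffMeasure_real, Real.volume_Icc, ENNReal.coe_one, ENNReal.one_rpow, one_mul] at this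

/-- This is how distances are bounded below: `f` acts as a calibration, and the image of an optimal
curve has `H¹` measure at most `arcDist q x y`. -/
theorem abs_sub_le_arcDist (hq : ∀ i j, i ≠ j → dist (q i) (q j) = 1)
    {f : EuclideanSpace ℝ (Fin n) → ℝ} {N₀ : ℕ}
    (hf : ∀ w : List (Fin (n + 1)), N₀ ≤ w.length → ∀ x ∈ cell q w, ∀ y ∈ cell q w,
      |f x - f y| ≤ (1 / 2 : ℝ) ^ w.length)
    {x y : EuclideanSpace ℝ (Fin n)} (hx : x ∈ gasket q) (hy : y ∈ gasket q) :
    |f x - f y| ≤ arcDist q x y := by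
  obtain ⟨hL, g, hg, hgm, h0, h1⟩ := reachableIn_arcDist hq hx hy
  have h2 := ofReal_abs_sub_le_hausdorffMeasure hq hf
    (isPreconnected_Icc.image g hg.continuous.continuousOn) (image_subset_iff.2 fun s _ => hgm s)
    (mem_image_of_mem g (left_mem_Icc.2 hL)) (mem_image_of_mem g (right_mem_Icc.2 hL))
  rw [h0, h1] at h2
  have h3 := h2.trans (hausdorffMeasure_image_Icc_le hg _ _)
  rw [sub_zero] at h3
  exact (ENNReal.ofReal_le_ofReal_iff hL).1 h3

/-! ### The intrinsic metric and the existence of geodesics. -/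

/-- The path attached to a curve of bounded speed, run at constant speed. -/
def ReachableIn.path {x y : EuclideanSpace ℝ (Fin n)} {L : ℝ} (h : ReachableIn q x y L) :
    Path x y where
  toFun s := h.2.choose (s * L)
  continuous_toFun := h.2.choose_spec.1.continuous.comp (by fun_prop)
  source' := by simpa using h.2.choose_spec.2.2.1
  target' := by simpa using h.2.choose_spec.2.2.2

theorem ReachableIn.path_mem_gasket {x y : EuclideanSpace ℝ (Fin n)} {L : ℝ}
    (h : ReachableIn q x y L) (s : I) : h.path s ∈ gasket q :=
  h.2.choose_spec.2.1 _

theorem ReachableIn.hausdorffMeasure_path_le {x y : EuclideanSpace ℝ (Fin n)} {L : ℝ}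
    (h : ReachableIn q x y L) (a b : I) :
    Measure.hausdorffMeasure 1 (h.path '' Icc a b) ≤ ENNReal.ofReal ((b - a) * L) := by
  rw [sub_mul]
  refine le_trans (measure_mono ?_) (hausdorffMeasure_image_Icc_le h.2.choose_spec.1 _ _)
  rintro _ ⟨s, hs, rfl⟩
  exact ⟨s * L, ⟨mul_le_mul_of_nonneg_right hs.1 h.1, mul_le_mul_of_nonneg_right hs.2 h.1⟩, rfl⟩

theorem intrinsicDist_eq_arcDist (hq : ∀ i j, i ≠ j → dist (q i) (q j) = 1)
    {x y : EuclideanSpace ℝ (Fin n)} (hx : x ∈ gasket q) (hy : y ∈ gasket q) :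
    intrinsicDist q x y = ENNReal.ofReal (arcDist q x y) := by
  refine le_antisymm ?_ (le_iInf₂ fun γ hγ => ?_)
  · have h := reachableIn_arcDist hq hx hy
    refine (iInf₂_le h.path h.path_mem_gasket).trans ?_
    have := h.hausdorffMeasure_path_le 0 1
    rw [Icc.coe_one, Icc.coe_zero, sub_zero, one_mul] at this
    refine le_trans (measure_mono ?_) this
    rw [← image_univ]
    exact image_mono fun r _ => ⟨unitInterval.nonneg r, unitInterval.le_one r⟩
  · exact ofReal_arcDist_le_hausdorffMeasure hq (isPreconnected_range γ.continuous)
      (range_subset_iff.2 hγ) ⟨0, γ.source⟩ ⟨1, γ.target⟩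

/-- The parts before and after time `s` have lengths at most `s` and `1 - s` times the distance.
Together they must cover the full distance, so both bounds are equalities. -/
theorem ReachableIn.isGeodesic (hq : ∀ i j, i ≠ j → dist (q i) (q j) = 1)
    {x y : EuclideanSpace ℝ (Fin n)} (hx : x ∈ gasket q) (hy : y ∈ gasket q)
    (h : ReachableIn q x y (arcDist q x y)) : IsGeodesic q h.path := by
  have hL := arcDist_nonneg (q := q) x y
  have hle : ∀ s : I, Measure.hausdorffMeasure 1 (h.path '' Iic s) ≤
      ENNReal.ofReal (s * arcDist q x y) := by
    intro s
    have := h.hausdorffMeasure_path_le 0 s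
    rw [Icc.coe_zero, sub_zero] at this
    refine le_trans (measure_mono (image_mono fun r hr => ?_)) this
    exact ⟨unitInterval.nonneg r, hr⟩
  have hge : ∀ s : I, Measure.hausdorffMeasure 1 (h.path '' Ici s) ≤
      ENNReal.ofReal ((1 - s) * arcDist q x y) := by
    intro s
    have := h.hausdorffMeasure_path_le s 1
    rw [Icc.coe_one] at this
    refine le_trans (measure_mono (image_mono fun r hr => ?_)) this
    exact ⟨hr, unitInterval.le_one r⟩
  have hlow : ENNReal.ofReal (arcDist q x y) ≤ pathLength h.path :=
    ofReal_arcDist_le_hausdorffMeasure hq (isPreconnected_range h.path.continuous)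
      (range_subset_iff.2 h.path_mem_gasket) ⟨0, h.path.source⟩ ⟨1, h.path.target⟩
  have hlen : pathLength h.path = ENNReal.ofReal (arcDist q x y) := by
    refine le_antisymm ?_ hlow
    have := hle 1
    rw [Icc.coe_one, one_mul] at this
    refine le_trans (measure_mono ?_) this
    rw [← image_univ]
    exact image_mono fun r _ => unitInterval.le_one r
  refine ⟨h.path_mem_gasket, by rw [hlen, intrinsicDist_eq_arcDist hq hx hy], fun s => ?_⟩
  rw [hlen, ← ENNReal.ofReal_mul (unitInterval.nonneg s)]
  refine le_antisymm (hle s) ?_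
  have h1 : ENNReal.ofReal (s * arcDist q x y) + ENNReal.ofReal ((1 - s) * arcDist q x y) ≤
      Measure.hausdorffMeasure 1 (h.path '' Iic s) +
        ENNReal.ofReal ((1 - s) * arcDist q x y) := by
    rw [← ENNReal.ofReal_add (mul_nonneg (unitInterval.nonneg s) hL)
      (mul_nonneg (unitInterval.one_minus_nonneg s) hL)]
    calc ENNReal.ofReal (s * arcDist q x y + (1 - s) * arcDist q x y)
        = ENNReal.ofReal (arcDist q x y) := by ring_nf
      _ ≤ pathLength h.path := hlow
      _ ≤ Measure.hausdorffMeasure 1 (h.path '' Iic s ∪ h.path '' Ici s) := by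
          refine measure_mono ?_
          rw [← image_union, Iic_union_Ici, image_univ]
      _ ≤ _ := (measure_union_le _ _).trans (by gcongr; exact hge s)
  exact (ENNReal.add_le_add_iff_right ENNReal.ofReal_ne_top).1 h1

/-! ### Distances to the corners of a cell, and the exit of curves from a cell. -/

theorem abs_bary_sub_le_arcDist (hq : ∀ i j, i ≠ j → dist (q i) (q j) = 1) (i : Fin (n + 1))
    {x y : EuclideanSpace ℝ (Fin n)} (hx : x ∈ gasket q) (hy : y ∈ gasket q) :
    |bary q i x - bary q i y| ≤ arcDist q x y := by
  refine abs_sub_le_arcDist hq (N₀ := 0) ?_ hx hy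
  rintro w - _ ⟨x, hx, rfl⟩ _ ⟨y, hy, rfl⟩
  rw [bary_wordMap_sub hq, abs_mul, abs_of_nonneg (by positivity)]
  refine mul_le_of_le_one_right (by positivity) ?_
  have := bary_nonneg hq i hx
  have := bary_nonneg hq i hy
  have := bary_le_one hq i hx
  have := bary_le_one hq i hy
  rw [abs_le]
  constructor <;> linarith

/-- The curve of `reachableIn_vertex` is optimal because the coordinate `l` changes at speed at most
one along any curve. -/
theorem arcDist_vertex (hq : ∀ i j, i ≠ j → dist (q i) (q j) = 1) (l : Fin (n + 1))
    (w : List (Fin (n + 1))) {x : EuclideanSpace ℝ (Fin n)} (hx : x ∈ gasket q) :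
    arcDist q (wordMap q w x) (wordMap q w (q l)) = (1 / 2) ^ w.length * (1 - bary q l x) := by
  refine le_antisymm ((reachableIn_vertex hq l hx).map_wordMap w).arcDist_le ?_
  have := abs_bary_sub_le_arcDist hq l (wordMap_mem_gasket w hx)
    (wordMap_mem_gasket w (vertex_mem_gasket l))
  rw [bary_wordMap_sub hq, bary_vertex hq, if_pos rfl] at this
  linarith [neg_abs_le ((1 / 2 : ℝ) ^ w.length * (bary q l x - 1))]

/-- The distance from a point of a cell to a vertex of the cell, read off from the barycentric
coordinates in the gasket. -/
theorem arcDist_cell_vertex (hq : ∀ i j, i ≠ j → dist (q i) (q j) = 1) (l : Fin (n + 1))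
    {w : List (Fin (n + 1))} {x : EuclideanSpace ℝ (Fin n)} (hx : x ∈ cell q w) :
    arcDist q x (wordMap q w (q l)) = bary q l (wordMap q w (q l)) - bary q l x := by
  obtain ⟨x, hx, rfl⟩ := hx
  rw [arcDist_vertex hq l w hx, bary_wordMap_sub hq, bary_vertex hq, if_pos rfl]

/-- Curves leave a cell through its vertices. -/
theorem exists_vertex_arcDist_add_le (hq : ∀ i j, i ≠ j → dist (q i) (q j) = 1)
    {u : List (Fin (n + 1))} {x y : EuclideanSpace ℝ (Fin n)} (hx : x ∈ cell q u)
    (hy : y ∈ gasket q) (hyu : y ∉ cell q u) :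
    ∃ l, arcDist q x (wordMap q u (q l)) + arcDist q (wordMap q u (q l)) y ≤ arcDist q x y := by
  classical
  have hxS := cell_subset_gasket u hx
  set V : Fin (n + 1) → EuclideanSpace ℝ (Fin n) := fun l => wordMap q u (q l) with hV
  have hVS : ∀ l, V l ∈ gasket q := fun l => wordMap_mem_gasket u (vertex_mem_gasket l)
  set h : EuclideanSpace ℝ (Fin n) → ℝ := fun z => ⨅ l, (arcDist q x (V l) + arcDist q (V l) z)
    with hh
  have hle : ∀ z l, h z ≤ arcDist q x (V l) + arcDist q (V l) z := fun z l =>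
    ciInf_le (Set.finite_range _).bddBelow l
  have hex : ∀ z, ∃ l, arcDist q x (V l) + arcDist q (V l) z = h z := fun z =>
    exists_eq_ciInf_of_finite
  have hvert : ∀ m, h (V m) = arcDist q x (V m) := by
    intro m
    refine le_antisymm ?_ ?_
    · have := hle (V m) m
      rwa [arcDist_self (hVS m), add_zero] at this
    · obtain ⟨l, hl⟩ := hex (V m)
      rw [← hl]
      exact arcDist_triangle hq hxS (hVS l) (hVS m)
  have hlip : ∀ z z', z ∈ gasket q → z' ∈ gasket q → h z - h z' ≤ arcDist q z z' := by
    intro z z' hz hz'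
    obtain ⟨l, hl⟩ := hex z'
    have h1 := hle z l
    have h2 := arcDist_triangle hq (hVS l) hz' hz
    rw [arcDist_comm z' z] at h2
    linarith
  -- Outside `[u]` the function `h` measures the distance from `x` through the best corner of `[u]`.
  -- It agrees with `arcDist q x` at the corners. A cell at least as deep as `u` lies in `[u]` or
  -- meets it only in corners, so `f` is a calibration, and `f y - f x = h y`.
  set f : EuclideanSpace ℝ (Fin n) → ℝ := fun z => if z ∈ cell q u then arcDist q x z else h z
    with hf
  have hfl : ∀ w : List (Fin (n + 1)), u.length ≤ w.length → ∀ z ∈ cell q w, ∀ z' ∈ cell q w,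
      |f z - f z'| ≤ (1 / 2 : ℝ) ^ w.length := by
    intro w hw z hz z' hz'
    by_cases hp : u <+: w
    · have := cell_subset_of_prefix (q := q) hp
      simp only [hf, if_pos (this hz), if_pos (this hz')]
      exact abs_arcDist_sub_le_of_mem_cell hq hxS w hz hz'
    · have hfh : ∀ z ∈ cell q w, f z = h z := by
        intro z hz
        by_cases hzu : z ∈ cell q u
        · obtain ⟨l, hl⟩ := exists_vertex_of_mem_cell_of_not_prefix hq hw hp hzu hz
          simp only [hf, if_pos hzu]
          rw [hl]
          exact (hvert l).symm
        · simp only [hf, if_neg hzu]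
      rw [hfh z hz, hfh z' hz']
      have h1 := hlip z z' (cell_subset_gasket w hz) (cell_subset_gasket w hz')
      have h2 := hlip z' z (cell_subset_gasket w hz') (cell_subset_gasket w hz)
      rw [arcDist_comm z' z] at h2
      refine le_trans ?_ (arcDist_le_of_mem_cell hq hz hz')
      rw [abs_le]
      constructor <;> linarith
  have h1 := abs_sub_le_arcDist hq hfl hy hxS
  simp only [hf, if_pos hx, if_neg hyu, arcDist_self hxS, sub_zero] at h1
  obtain ⟨l, hl⟩ := hex y
  refine ⟨l, ?_⟩
  rw [arcDist_comm y x] at h1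
  exact hl.le.trans ((le_abs_self _).trans h1)

/-- A curve from the subcell `[ui]` to the subcell `[uj]` of `[u]` need not leave `[ui]` through
the vertex that it shares with `[u]`. -/
theorem exists_vertex_ne_arcDist_add_le (hq : ∀ i j, i ≠ j → dist (q i) (q j) = 1)
    {u : List (Fin (n + 1))} {i j : Fin (n + 1)} (hij : i ≠ j) {x y : EuclideanSpace ℝ (Fin n)}
    (hx : x ∈ cell q (u ++ [i])) (hy : y ∈ cell q (u ++ [j])) :
    ∃ l, l ≠ i ∧ arcDist q x (wordMap q (u ++ [i]) (q l)) +
      arcDist q (wordMap q (u ++ [i]) (q l)) y ≤ arcDist q x y := by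
  have hyS := cell_subset_gasket _ hy
  have hxS := cell_subset_gasket _ hx
  have hVm : ∀ w : List (Fin (n + 1)), ∀ l, wordMap q w (q l) ∈ gasket q := fun w l =>
    wordMap_mem_gasket w (vertex_mem_gasket l)
  have hlen : ∀ k : Fin (n + 1), (u ++ [k]).length = u.length + 1 := by simp
  have hcell : ∀ k l : Fin (n + 1), wordMap q (u ++ [k]) (q l) = wordMap q u (contr q k (q l)) := by
    intro k l
    rw [wordMap_append]
    rfl
  have hcomm : wordMap q (u ++ [i]) (q j) = wordMap q (u ++ [j]) (q i) := by
    rw [hcell, hcell, contr_vertex_comm]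
  -- If `y` lies in both subcells, it is their common corner, and this is the vertex sought.
  by_cases hyC : y ∈ cell q (u ++ [i])
  · have hne : u ++ [j] ≠ u ++ [i] := by simpa using hij.symm
    obtain ⟨z, hz, hzy⟩ := hyC
    obtain ⟨z', hz', hzy'⟩ := hy
    have h1 : contr q i z = contr q j z' := by
      apply wordMap_injective (q := q) u
      have e1 : wordMap q (u ++ [i]) z = wordMap q u (contr q i z) := by rw [wordMap_append]; rfl
      have e2 : wordMap q (u ++ [j]) z' = wordMap q u (contr q j z') := by rw [wordMap_append]; rfl
      rw [← e1, ← e2, hzy, hzy']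
    have h2 := eq_vertex_of_contr_eq hq hij hz hz' h1
    subst h2
    refine ⟨j, hij.symm, ?_⟩
    rw [hzy, arcDist_self hyS, add_zero]
  obtain ⟨l, hl⟩ := exists_vertex_arcDist_add_le hq hx hyS hyC
  rcases ne_or_eq l i with hli | rfl
  · exact ⟨l, hli, hl⟩
  have hV : wordMap q (u ++ [l]) (q l) = wordMap q u (q l) := by rw [hcell, contr_vertex]
  have hVC : wordMap q u (q l) ∉ cell q (u ++ [j]) := by
    rintro ⟨z, hz, hzl⟩
    have h1 : contr q l (q l) = contr q j z := by
      apply wordMap_injective (q := q) u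
      rw [contr_vertex, ← hzl, wordMap_append]
      rfl
    exact hij (vertex_injective hq (eq_vertex_of_contr_eq hq hij (vertex_mem_gasket l) hz h1))
  -- Here the exit is the outer corner of `[u]`, and the curve enters `[uj]` at a corner `m`. With
  -- `s = 2^(-|u|-1)`, the way from the outer corner to `m` takes at least `2s`, or `s` if `m = l`.
  -- Going from `x` to `m` through the midpoint shared by both subcells takes no longer.
  obtain ⟨m, hm⟩ := exists_vertex_arcDist_add_le hq hy (hVm u l) hVC
  refine ⟨j, hij.symm, ?_⟩
  rw [hV] at hl
  have e1 : arcDist q x (wordMap q (u ++ [l]) (q j)) ≤ (1 / 2) ^ (u.length + 1) := by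
    rw [← hlen l]
    exact arcDist_le_of_mem_cell hq hx (wordMap_vertex_mem_cell _ j)
  have e2 := arcDist_triangle hq (hVm (u ++ [l]) j) (hVm (u ++ [j]) m) hyS
  have e3 : arcDist q (wordMap q (u ++ [l]) (q j)) (wordMap q (u ++ [j]) (q m)) ≤
      (1 / 2) ^ (u.length + 1) * (1 - if l = m then (1 : ℝ) else 0) := by
    rw [hcomm, arcDist_vertex hq m _ (vertex_mem_gasket l), bary_vertex hq, hlen]
  have e4 := abs_bary_sub_le_arcDist hq l (hVm u l) (hVm (u ++ [j]) m)
  rw [hcell, bary_wordMap_sub hq, bary_contr hq, bary_vertex hq, bary_vertex hq, if_pos rfl,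
    if_neg hij.symm, ← hcell] at e4
  have e5 := (le_abs_self _).trans e4
  have hc := arcDist_comm (q := q) (wordMap q (u ++ [j]) (q m)) (wordMap q u (q l))
  have hc2 := arcDist_comm (q := q) (wordMap q u (q l)) y
  have hc3 := arcDist_comm (q := q) (wordMap q (u ++ [j]) (q m)) y
  have hn0 := arcDist_nonneg (q := q) x (wordMap q u (q l))
  have hp : (1 / 2 : ℝ) ^ u.length = 2 * (1 / 2) ^ (u.length + 1) := by
    rw [pow_succ]
    ring
  rw [hp] at e5
  by_cases hlm : l = m
  · rw [if_pos hlm] at e3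
    rw [if_pos hlm.symm] at e5
    linarith
  · rw [if_neg hlm] at e3
    rw [if_neg (Ne.symm hlm)] at e5
    linarith

/-! ### The lower bound -/

/-- The edge from the vertex `l` to the vertex `m` of the cell `[w]`. -/
def edge {n : ℕ} (q : Fin (n + 1) → EuclideanSpace ℝ (Fin n))
    (e : List (Fin (n + 1)) × Fin (n + 1) × Fin (n + 1)) : Set (EuclideanSpace ℝ (Fin n)) :=
  (fun c : ℝ => wordMap q e.1 ((1 - c) • q e.2.1 + c • q e.2.2)) '' Icc 0 1

theorem isCompact_edge (e : List (Fin (n + 1)) × Fin (n + 1) × Fin (n + 1)) :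
    IsCompact (edge q e) :=
  isCompact_Icc.image ((continuous_wordMap e.1).comp (by fun_prop))

theorem arcDist_combination_le (hq : ∀ i j, i ≠ j → dist (q i) (q j) = 1)
    (w : List (Fin (n + 1))) (l m : Fin (n + 1)) {c d : ℝ} (hc : c ∈ Icc (0 : ℝ) 1)
    (hd : d ∈ Icc (0 : ℝ) 1) :
    arcDist q (wordMap q w ((1 - c) • q l + c • q m)) (wordMap q w ((1 - d) • q l + d • q m)) ≤
      (1 / 2) ^ w.length * |c - d| :=
  ((reachableIn_combination hq l m hc hd).map_wordMap w).arcDist_le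

theorem edge_subset_gasket (hq : ∀ i j, i ≠ j → dist (q i) (q j) = 1)
    (e : List (Fin (n + 1)) × Fin (n + 1) × Fin (n + 1)) : edge q e ⊆ gasket q := by
  rintro _ ⟨c, hc, rfl⟩
  exact wordMap_mem_gasket _ (combination_mem_gasket hq _ _ hc)

/-- The arc length distance of two points of an edge is at most their Euclidean distance, because
the edge is a straight segment inside the gasket. -/
theorem lipschitzOnWith_arcDist_edge (hq : ∀ i j, i ≠ j → dist (q i) (q j) = 1)
    {x : EuclideanSpace ℝ (Fin n)} (hx : x ∈ gasket q)
    (e : List (Fin (n + 1)) × Fin (n + 1) × Fin (n + 1)) :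
    LipschitzOnWith 1 (arcDist q x) (edge q e) := by
  refine LipschitzOnWith.of_dist_le_mul fun y hy z hz => ?_
  have h := abs_arcDist_sub_le hq hx (edge_subset_gasket hq e hy) (edge_subset_gasket hq e hz)
  obtain ⟨w, l, m⟩ := e
  obtain ⟨c, hc, rfl⟩ := hy
  obtain ⟨d, hd, rfl⟩ := hz
  rw [Real.dist_eq, NNReal.coe_one, one_mul]
  refine h.trans ?_
  rcases eq_or_ne l m with rfl | hlm
  · have h1 : ∀ c : ℝ, (1 - c) • q l + c • q l = q l := fun c => by module
    simp only [h1, dist_self]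
    exact (arcDist_self (wordMap_mem_gasket w (vertex_mem_gasket l))).le
  · rw [dist_wordMap, dist_combination, hq l m hlm, mul_one]
    exact arcDist_combination_le hq w l m hc hd

/-- Interior points of geodesics lie on edges. -/
theorem exists_mem_edge_of_between (hq : ∀ i j, i ≠ j → dist (q i) (q j) = 1)
    {a b x : EuclideanSpace ℝ (Fin n)} (ha : a ∈ gasket q) (hb : b ∈ gasket q) (hx : x ∈ gasket q)
    (hxa : x ≠ a) (hxb : x ≠ b) (h : arcDist q a x + arcDist q x b ≤ arcDist q a b) :
    ∃ e, x ∈ edge q e := by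
  -- A cell of generation `N` around `x` is too small to contain `a` or `b`, so the geodesic enters
  -- it at a corner `l` and leaves it at a corner `m`.
  obtain ⟨N, hN⟩ := exists_pow_lt_of_lt_one (lt_min (dist_pos.2 hxa) (dist_pos.2 hxb))
    (by norm_num : (1 / 2 : ℝ) < 1)
  obtain ⟨w, hw, hxw⟩ := exists_cell_of_mem_gasket N hx
  have hout : ∀ y ∈ gasket q, (1 / 2 : ℝ) ^ N < dist x y → y ∉ cell q w := by
    intro y hy hxy hyw
    have h1 := arcDist_le_of_mem_cell hq hxw hyw
    have h2 := dist_le_arcDist hq hx hy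
    rw [hw] at h1
    linarith
  obtain ⟨l, hl⟩ := exists_vertex_arcDist_add_le hq hxw ha
    (hout a ha (hN.trans_le (min_le_left _ _)))
  obtain ⟨m, hm⟩ := exists_vertex_arcDist_add_le hq hxw hb
    (hout b hb (hN.trans_le (min_le_right _ _)))
  have hlS : wordMap q w (q l) ∈ gasket q := wordMap_mem_gasket w (vertex_mem_gasket l)
  have hmS : wordMap q w (q m) ∈ gasket q := wordMap_mem_gasket w (vertex_mem_gasket m)
  have h1 := arcDist_triangle hq ha hlS hb
  have h2 := arcDist_triangle hq hlS hmS hb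
  rw [arcDist_comm a (wordMap q w (q l))] at h1
  rw [arcDist_comm a x] at h
  obtain ⟨z, hz, rfl⟩ := hxw
  rw [arcDist_vertex hq l w hz] at hl
  rw [arcDist_vertex hq m w hz] at hm
  have h3 := arcDist_vertex hq m w (vertex_mem_gasket (q := q) l)
  have hp : (0 : ℝ) < (1 / 2) ^ w.length := by positivity
  rw [bary_vertex hq] at h3
  -- The point `x` lies between the two corners. In coordinates of the cell this says that the
  -- coordinates `l` and `m` add up to at least one, or that `x` is the corner when `l = m`.
  have h4 : (1 / 2 : ℝ) ^ w.length * (1 - bary q l z) + (1 / 2) ^ w.length * (1 - bary q m z) ≤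
      (1 / 2) ^ w.length * (1 - if l = m then 1 else 0) := by linarith
  rw [← mul_add, mul_le_mul_iff_of_pos_left hp] at h4
  refine ⟨(w, l, m), bary q m z, ⟨bary_nonneg hq m hz, bary_le_one hq m hz⟩, ?_⟩
  change wordMap q w ((1 - bary q m z) • q l + bary q m z • q m) = wordMap q w z
  congr 1
  rcases eq_or_ne l m with rfl | hlm
  · rw [if_pos rfl] at h4
    rw [eq_vertex_of_bary hq hz (by linarith)]
    module
  · rw [if_neg hlm] at h4
    exact (eq_combination_of_bary hq hlm hz (by linarith)).symm

theorem exists_eq_append_of_not_prefix {α : Type*} {v w : List α} (h : ¬ v <+: w)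
    (h' : ¬ w <+: v) :
    ∃ (u : List α) (i j : α) (v' w' : List α), i ≠ j ∧ v = u ++ [i] ++ v' ∧
      w = u ++ [j] ++ w' := by
  induction v generalizing w with
  | nil => exact absurd (List.nil_prefix) h
  | cons i v ih =>
    cases w with
    | nil => exact absurd (List.nil_prefix) h'
    | cons j w =>
      by_cases hij : i = j
      · subst hij
        rw [List.prefix_cons_inj] at h h'
        obtain ⟨u, k, l, v', w', hkl, rfl, rfl⟩ := ih h h'
        exact ⟨i :: u, k, l, v', w', hkl, rfl, rfl⟩
      · exact ⟨[], i, j, v, w, hij, rfl, rfl⟩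

/-- Geodesics from the corner `i` of a cell inside `[ui]` to `[uj]` can be chosen to run along an
edge of the cell. -/
theorem exists_edge_toward (hq : ∀ i j, i ≠ j → dist (q i) (q j) = 1)
    {u v' : List (Fin (n + 1))} {i j : Fin (n + 1)} (hij : i ≠ j) {y : EuclideanSpace ℝ (Fin n)}
    (hy : y ∈ cell q (u ++ [j])) :
    ∃ l, (1 / 2) ^ (u ++ [i] ++ v').length + arcDist q (wordMap q (u ++ [i] ++ v') (q l)) y ≤
      arcDist q (wordMap q (u ++ [i] ++ v') (q i)) y := by
  have hsub := cell_append_subset (q := q) (u ++ [i]) v'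
  have hmem : ∀ k, wordMap q (u ++ [i] ++ v') (q k) ∈ cell q (u ++ [i]) := fun k =>
    hsub (wordMap_vertex_mem_cell _ k)
  -- Inside `[ui]` the distance to the exit corner `l ≠ i` is read off from the coordinate `l`,
  -- which rises by the full side of the smaller cell along its edge from corner `i` to corner `l`.
  obtain ⟨l, hli, hl⟩ := exists_vertex_ne_arcDist_add_le hq hij (hmem i) hy
  refine ⟨l, ?_⟩
  rw [arcDist_cell_vertex hq l (hmem i)] at hl
  have h1 := arcDist_cell_vertex hq l (hmem l)
  have h2 := bary_wordMap_sub hq l (u ++ [i] ++ v') (q l) (q i)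
  rw [bary_vertex hq, bary_vertex hq, if_pos rfl, if_neg hli.symm] at h2
  have h3 := arcDist_triangle hq (cell_subset_gasket _ (hmem l))
    (wordMap_mem_gasket (u ++ [i]) (vertex_mem_gasket l)) (cell_subset_gasket _ hy)
  linarith

/-- Asking for only one intermediate point per pair makes the bound apply to both kinds of
interpolant. -/
theorem ofReal_le_hausdorffMeasure_of_between (hq : ∀ i j, i ≠ j → dist (q i) (q j) = 1)
    {v w : List (Fin (n + 1))} (hvw : Disjoint (cell q v) (cell q w)) {t : ℝ}
    (ht : t ∈ Icc (0 : ℝ) 1) {E : Set (EuclideanSpace ℝ (Fin n))}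
    (hE : ∀ a ∈ cell q v, ∀ b ∈ cell q w, ∃ x ∈ E, x ∈ gasket q ∧
      arcDist q a x = t * arcDist q a b ∧ arcDist q x b = (1 - t) * arcDist q a b) :
    ENNReal.ofReal ((1 - t) * (1 / 2) ^ v.length + t * (1 / 2) ^ w.length) ≤
      Measure.hausdorffMeasure 1 E := by
  obtain ⟨u, i, j, v', w', hij, hv, hw⟩ := exists_eq_append_of_not_prefix
    (fun h => not_disjoint_cell_of_prefix h hvw)
    (fun h => not_disjoint_cell_of_prefix h hvw.symm)
  have hvS : ∀ k, wordMap q v (q k) ∈ gasket q := fun k =>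
    wordMap_mem_gasket v (vertex_mem_gasket k)
  have hwS : ∀ k, wordMap q w (q k) ∈ gasket q := fun k =>
    wordMap_mem_gasket w (vertex_mem_gasket k)
  obtain ⟨l, hl⟩ : ∃ l, (1 / 2) ^ v.length + arcDist q (wordMap q v (q l)) (wordMap q w (q j)) ≤
      arcDist q (wordMap q v (q i)) (wordMap q w (q j)) := by
    rw [hv]
    refine exists_edge_toward hq hij ?_
    rw [hw]
    exact cell_append_subset _ _ (wordMap_vertex_mem_cell _ j)
  obtain ⟨m, hm⟩ : ∃ m, (1 / 2) ^ w.length + arcDist q (wordMap q w (q m)) (wordMap q v (q l)) ≤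
      arcDist q (wordMap q w (q j)) (wordMap q v (q l)) := by
    rw [hw]
    refine exists_edge_toward hq hij.symm ?_
    rw [hv]
    exact cell_append_subset _ _ (wordMap_vertex_mem_cell _ l)
  set δ : ℝ := (1 / 2) ^ v.length with hδ
  set ε : ℝ := (1 / 2) ^ w.length with hε
  have hδ0 : 0 < δ := by positivity
  have hε0 : 0 < ε := by positivity
  set a₀ := wordMap q v (q i) with ha₀
  set b₀ := wordMap q w (q j) with hb₀
  set a₁ := wordMap q v (q l) with ha₁
  set b₁ := wordMap q w (q m) with hb₁
  set L := arcDist q a₀ b₀ with hL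
  rw [arcDist_comm b₁ a₁, arcDist_comm b₀ a₁] at hm
  set a : ℝ → EuclideanSpace ℝ (Fin n) := fun c => wordMap q v ((1 - c) • q i + c • q l) with ha
  set b : ℝ → EuclideanSpace ℝ (Fin n) := fun c => wordMap q w ((1 - c) • q j + c • q m) with hb
  have ha0 : a 0 = a₀ := by simp [ha, ha₀]
  have ha1 : a 1 = a₁ := by simp [ha, ha₁]
  have hb0 : b 0 = b₀ := by simp [hb, hb₀]
  have hb1 : b 1 = b₁ := by simp [hb, hb₁]
  have h0 : (0 : ℝ) ∈ Icc (0 : ℝ) 1 := by simp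
  have h1 : (1 : ℝ) ∈ Icc (0 : ℝ) 1 := by simp
  -- Only the part of `E` on edges is kept, since `arcDist q b₀` is 1-Lipschitz there.
  set E' := E ∩ ⋃ e, edge q e with hE'
  have himage : Icc ((1 - t) * (L - δ)) ((1 - t) * L + t * ε) ⊆ arcDist q b₀ '' E' := by
    intro y hy
    have hpos : 0 < (1 - t) * δ + t * ε := by
      rcases ht.1.eq_or_lt with h | h
      · rw [← h]; linarith
      · nlinarith [ht.2, mul_pos h hε0, mul_nonneg (sub_nonneg.2 ht.2) hδ0.le]
    -- As `c'` grows from `0` to `1`, `b` moves from `b₀` to `b₁` while `a` moves from `a₁` back to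
    -- `a₀`, whence `c = 1 - c'`. Both motions push the intermediate point away from `b₀`, at total
    -- rate `(1-t)δ + tε`.
    obtain ⟨c', hc', hyc⟩ : ∃ c' ∈ Icc (0 : ℝ) 1,
        y = (1 - t) * (L - δ * (1 - c')) + t * (ε * c') := by
      refine ⟨(y - (1 - t) * (L - δ)) / ((1 - t) * δ + t * ε),
        ⟨div_nonneg (sub_nonneg.2 hy.1) hpos.le, (div_le_one hpos).2 (by linarith [hy.2])⟩, ?_⟩
      have := div_mul_cancel₀ (y - (1 - t) * (L - δ)) hpos.ne'
      linear_combination (-1) * this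
    set c : ℝ := 1 - c' with hc
    have hcI : c ∈ Icc (0 : ℝ) 1 := ⟨by linarith [hc'.2], by linarith [hc'.1]⟩
    have hacell : a c ∈ cell q v := ⟨_, combination_mem_gasket hq i l hcI, rfl⟩
    have hbcell : b c' ∈ cell q w := ⟨_, combination_mem_gasket hq j m hc', rfl⟩
    have haS := cell_subset_gasket v hacell
    have hbS := cell_subset_gasket w hbcell
    have e1 : arcDist q a₀ (a c) ≤ δ * c := by
      have := arcDist_combination_le hq v i l h0 hcI
      rw [zero_sub, abs_neg, abs_of_nonneg hcI.1] at this
      rwa [← ha0]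
    have e2 : arcDist q (a c) a₁ ≤ δ * (1 - c) := by
      have := arcDist_combination_le hq v i l hcI h1
      rw [abs_sub_comm, abs_of_nonneg (sub_nonneg.2 hcI.2)] at this
      rwa [← ha1]
    have e3 : arcDist q b₀ (b c') ≤ ε * c' := by
      have := arcDist_combination_le hq w j m h0 hc'
      rw [zero_sub, abs_neg, abs_of_nonneg hc'.1] at this
      rwa [← hb0]
    have e4 : arcDist q (b c') b₁ ≤ ε * (1 - c') := by
      have := arcDist_combination_le hq w j m hc' h1
      rw [abs_sub_comm, abs_of_nonneg (sub_nonneg.2 hc'.2)] at this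
      rwa [← hb1]
    obtain ⟨x, hxE, hxS, hx1, hx2⟩ := hE (a c) hacell (b c') hbcell
    have f1 := arcDist_triangle hq haS (hvS l) hbS
    have f2 := arcDist_triangle hq (hvS l) (hwS m) hbS
    have f3 := arcDist_triangle hq (hvS i) haS (hwS j)
    have f4 := arcDist_triangle hq haS hbS (hwS j)
    have f5 := arcDist_triangle hq (hwS j) hbS hxS
    have f6 := arcDist_triangle hq haS hxS (hwS j)
    rw [arcDist_comm _ b₀] at f4
    rw [arcDist_comm b₁] at f2
    rw [arcDist_comm (b c') x] at f5
    rw [arcDist_comm x b₀] at f6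
    -- The points `a₀`, `a c`, `a₁`, `b₁`, `b c'`, `b₀` lie in this order on one geodesic, so all
    -- the triangle inequalities between them are equalities.
    have hab : arcDist q (a c) (b c') = L - δ * c - ε * c' := by linarith
    rw [hab] at hx1 hx2
    have hedge : x ∈ ⋃ e, edge q e := by
      rw [mem_iUnion]
      by_cases hxa : x = a c
      · exact ⟨(v, i, l), c, hcI, hxa.symm⟩
      by_cases hxb : x = b c'
      · exact ⟨(w, j, m), c', hc', hxb.symm⟩
      exact exists_mem_edge_of_between hq haS hbS hxS hxa hxb (by rw [hx1, hx2, hab]; linarith)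
    refine ⟨x, ⟨hxE, hedge⟩, ?_⟩
    rw [hyc]
    apply le_antisymm <;> linarith
  calc ENNReal.ofReal ((1 - t) * δ + t * ε)
      = volume (Icc ((1 - t) * (L - δ)) ((1 - t) * L + t * ε)) := by
        rw [Real.volume_Icc]
        ring_nf
    _ ≤ volume (arcDist q b₀ '' E') := measure_mono himage
    _ ≤ Measure.hausdorffMeasure 1 E' :=
        volume_image_le_of_cover (fun e => (isCompact_edge e).measurableSet) inter_subset_right
          fun e => (lipschitzOnWith_arcDist_edge hq (hwS j) e).mono inter_subset_right
    _ ≤ Measure.hausdorffMeasure 1 E := measure_mono inter_subset_left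

/-! ### Intermediate points -/

theorem exists_between (hq : ∀ i j, i ≠ j → dist (q i) (q j) = 1) {t : ℝ}
    (ht : t ∈ Icc (0 : ℝ) 1) {a b : EuclideanSpace ℝ (Fin n)} (ha : a ∈ gasket q)
    (hb : b ∈ gasket q) : ∃ x ∈ gasket q, arcDist q a x = t * arcDist q a b ∧
      arcDist q x b = (1 - t) * arcDist q a b := by
  obtain ⟨hL, g, hg, hgm, h0, h1⟩ := reachableIn_arcDist hq ha hb
  set L := arcDist q a b
  have e1 : arcDist q a (g (t * L)) ≤ t * L :=
    ReachableIn.arcDist_le ⟨mul_nonneg ht.1 hL, g, hg, hgm, h0, rfl⟩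
  have e2 : arcDist q (g (t * L)) b ≤ (1 - t) * L := by
    refine ReachableIn.arcDist_le ⟨mul_nonneg (sub_nonneg.2 ht.2) hL, fun s => g (t * L + s),
      LipschitzWith.of_dist_le_mul fun s s' => ?_, fun s => hgm _, by simp, ?_⟩
    · have := hg.dist_le_mul (t * L + s) (t * L + s')
      rwa [dist_add_left] at this
    · rw [← h1]
      ring_nf
  have e3 := arcDist_triangle hq ha (hgm (t * L)) hb
  exact ⟨g (t * L), hgm _, by linarith, by linarith⟩

theorem mem_fullInterpPt_iff (hq : ∀ i j, i ≠ j → dist (q i) (q j) = 1) (t : I)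
    {a b x : EuclideanSpace ℝ (Fin n)} (ha : a ∈ gasket q) (hb : b ∈ gasket q) :
    x ∈ fullInterpPt q t a b ↔ x ∈ gasket q ∧ arcDist q a x = t * arcDist q a b ∧
      arcDist q x b = (1 - t) * arcDist q a b := by
  have hL := arcDist_nonneg (q := q) a b
  unfold fullInterpPt
  refine and_congr_right fun hx => ?_
  rw [intrinsicDist_eq_arcDist hq ha hx, intrinsicDist_eq_arcDist hq hx hb,
    intrinsicDist_eq_arcDist hq ha hb, ← ENNReal.ofReal_mul (unitInterval.nonneg t),
    ← ENNReal.ofReal_mul (unitInterval.one_minus_nonneg t),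
    ENNReal.ofReal_eq_ofReal_iff (arcDist_nonneg _ _) (mul_nonneg (unitInterval.nonneg t) hL),
    ENNReal.ofReal_eq_ofReal_iff (arcDist_nonneg _ _)
      (mul_nonneg (unitInterval.one_minus_nonneg t) hL)]

/-! ### Geodesics -/

theorem hausdorffMeasure_one_singleton (x : EuclideanSpace ℝ (Fin n)) :
    Measure.hausdorffMeasure 1 {x} = 0 :=
  haveI := Measure.nullSingletonClass_hausdorff (EuclideanSpace ℝ (Fin n)) zero_lt_one
  measure_singleton x

/-- A geodesic spends at most the length `r` at distance at most `r` from its starting point. -/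
theorem IsGeodesic.hausdorffMeasure_le (hq : ∀ i j, i ≠ j → dist (q i) (q j) = 1)
    {a b : EuclideanSpace ℝ (Fin n)} {γ : Path a b} (hγ : IsGeodesic q γ)
    (hlen : pathLength γ = ENNReal.ofReal (arcDist q a b)) {r : ℝ} (hr : 0 ≤ r) :
    Measure.hausdorffMeasure 1 (range γ ∩ {x | arcDist q a x ≤ r}) ≤ ENNReal.ofReal r := by
  have hmem : ∀ s, γ s ∈ gasket q := hγ.1
  have ha : a ∈ gasket q := by simpa using hmem 0
  have hb : b ∈ gasket q := by simpa using hmem 1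
  rcases le_or_gt (arcDist q a b) r with hLr | hrL
  · refine (measure_mono inter_subset_left).trans ?_
    exact hlen.le.trans (ENNReal.ofReal_le_ofReal hLr)
  have hcont : ContinuousOn (arcDist q a) (range γ) :=
    (continuousOn_arcDist hq ha).mono (range_subset_iff.2 hmem)
  have hcontI : Continuous fun s => arcDist q a (γ s) :=
    hcont.comp_continuous γ.continuous fun s => mem_range_self s
  have hclosed : IsClosed (range γ ∩ {x | arcDist q a x ≤ r}) :=
    hcont.preimage_isClosed_of_isClosed (isCompact_range γ.continuous).isClosed isClosed_Iic
  -- After the last time `τ` at distance at most `r`, the geodesic stays beyond `r` and still has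
  -- length at least `arcDist q a b - r`. Subtracting this from the total length leaves at most `r`.
  obtain ⟨τ, hτ, hτmax⟩ := (isClosed_le hcontI continuous_const :
    IsClosed {s : I | arcDist q a (γ s) ≤ r}).isCompact.exists_isGreatest
      ⟨0, by simpa [arcDist_self ha] using hr⟩
  have hIoi : γ '' Ioi τ ⊆ range γ \ {x | arcDist q a x ≤ r} := by
    rintro _ ⟨s, hs, rfl⟩
    exact ⟨mem_range_self s, fun h => not_lt_of_ge (hτmax h) hs⟩
  have h1 : ENNReal.ofReal (arcDist q a b - r) ≤
      Measure.hausdorffMeasure 1 (range γ \ {x | arcDist q a x ≤ r}) := by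
    have e1 := arcDist_triangle hq ha (hmem τ) hb
    have e2 : arcDist q a (γ τ) ≤ r := hτ
    calc ENNReal.ofReal (arcDist q a b - r) ≤ ENNReal.ofReal (arcDist q (γ τ) b) :=
          ENNReal.ofReal_le_ofReal (by linarith)
      _ ≤ Measure.hausdorffMeasure 1 (γ '' Ici τ) :=
          ofReal_arcDist_le_hausdorffMeasure hq
            (isPreconnected_Ici.image γ γ.continuous.continuousOn)
            (image_subset_iff.2 fun s _ => hmem s) (mem_image_of_mem γ self_mem_Ici)
            ⟨1, unitInterval.le_one τ, γ.target⟩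
      _ ≤ Measure.hausdorffMeasure 1 (γ '' Ioi τ ∪ {γ τ}) := by
          refine measure_mono ?_
          rintro _ ⟨s, hs, rfl⟩
          rcases (mem_Ici.1 hs).eq_or_lt with h | h
          · exact Or.inr (by rw [h]; rfl)
          · exact Or.inl ⟨s, h, rfl⟩
      _ ≤ Measure.hausdorffMeasure 1 (γ '' Ioi τ) + 0 := by
          rw [← hausdorffMeasure_one_singleton (γ τ)]
          exact measure_union_le _ _
      _ ≤ _ := by
          rw [add_zero]
          exact measure_mono hIoi
  have h2 := measure_inter_add_sdiff (μ := Measure.hausdorffMeasure 1) (range γ)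
    hclosed.measurableSet
  rw [inter_eq_right.2 inter_subset_left, sdiff_self_inter] at h2
  have h3 : Measure.hausdorffMeasure 1 (range γ) =
      ENNReal.ofReal r + ENNReal.ofReal (arcDist q a b - r) := by
    rw [← ENNReal.ofReal_add hr (by linarith)]
    ring_nf
    exact hlen
  rw [h3] at h2
  refine (ENNReal.add_le_add_iff_right (a := ENNReal.ofReal (arcDist q a b - r))
    ENNReal.ofReal_ne_top).1 ?_
  rw [← h2]
  gcongr

/-- The arc length distance along a geodesic is proportional to time. -/
theorem IsGeodesic.arcDist_eq (hq : ∀ i j, i ≠ j → dist (q i) (q j) = 1)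
    {a b : EuclideanSpace ℝ (Fin n)} {γ : Path a b} (hγ : IsGeodesic q γ) (t : I) :
    arcDist q a (γ t) = t * arcDist q a b ∧ arcDist q (γ t) b = (1 - t) * arcDist q a b := by
  have hmem : ∀ s, γ s ∈ gasket q := hγ.1
  have ha : a ∈ gasket q := by simpa using hmem 0
  have hb : b ∈ gasket q := by simpa using hmem 1
  have hL := arcDist_nonneg (q := q) a b
  have hlen : pathLength γ = ENNReal.ofReal (arcDist q a b) := by
    rw [hγ.2.1, intrinsicDist_eq_arcDist hq ha hb]
  have hspeed : ∀ s : I, Measure.hausdorffMeasure 1 (γ '' Iic s) =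
      ENNReal.ofReal (s * arcDist q a b) := by
    intro s
    rw [hγ.2.2 s, hlen, ENNReal.ofReal_mul (unitInterval.nonneg s)]
  have hcontI : Continuous fun s => arcDist q a (γ s) :=
    (continuousOn_arcDist hq ha).comp_continuous γ.continuous hmem
  have hupper : ∀ s : I, arcDist q a (γ s) ≤ s * arcDist q a b := by
    intro s
    have := ofReal_arcDist_le_hausdorffMeasure hq
      (isPreconnected_Iic.image γ γ.continuous.continuousOn)
      (image_subset_iff.2 fun s _ => hmem s) (x := a) (y := γ s)
      ⟨0, unitInterval.nonneg s, γ.source⟩ (mem_image_of_mem γ self_mem_Iic)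
    rw [hspeed] at this
    exact (ENNReal.ofReal_le_ofReal_iff (mul_nonneg (unitInterval.nonneg s) hL)).1 this
  have heq : ∀ s : I, arcDist q a (γ s) = s * arcDist q a b := by
    intro s
    refine le_antisymm (hupper s) ?_
    -- Constant speed is a statement about images, so retracing must be excluded. With `L` the
    -- distance from `a` to `b`, the image of `[0, s]` has length `s * L` and stays within its
    -- largest distance from `a`, attained at `ρ ≤ s`. Hence `s * L ≤ arcDist q a (γ ρ) ≤ ρ * L`,
    -- and `ρ = s` unless `L = 0`.
    obtain ⟨ρ, hρ, hmax⟩ := (isClosed_Iic (a := s)).isCompact.exists_isMaxOn ⟨s, self_mem_Iic⟩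
      hcontI.continuousOn
    have h1 : s * arcDist q a b ≤ arcDist q a (γ ρ) := by
      refine (ENNReal.ofReal_le_ofReal_iff (arcDist_nonneg _ _)).1 ?_
      rw [← hspeed]
      refine (measure_mono ?_).trans (hγ.hausdorffMeasure_le hq hlen (arcDist_nonneg a (γ ρ)))
      rintro _ ⟨r, hr, rfl⟩
      exact ⟨mem_range_self r, hmax hr⟩
    rcases hL.eq_or_lt with h | h
    · rw [← h, mul_zero]
      exact arcDist_nonneg _ _
    · have h2 := h1.trans (hupper ρ)
      rw [mul_le_mul_iff_of_pos_right h] at h2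
      have h3 : ρ = s := le_antisymm hρ h2
      rwa [h3] at h1
  refine ⟨heq t, le_antisymm ?_ ?_⟩
  · rcases hL.eq_or_lt with h | h
    · have h1 := arcDist_triangle hq (hmem t) ha hb
      have h2 := heq t
      rw [arcDist_comm] at h2
      rw [h2, ← h] at h1
      rw [← h]
      linarith
    -- The distances from `a` separate the two images, so their lengths add up and the second one
    -- has length `(1 - t) * arcDist q a b`.
    have hdisj : Disjoint (γ '' Iic t) (γ '' Ioi t) := by
      rw [disjoint_left]
      rintro _ ⟨r, hr, rfl⟩ ⟨s, hs, hsr⟩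
      have h1 := heq r
      rw [← hsr, heq s] at h1
      have h2 := mul_right_cancel₀ h.ne' h1
      exact absurd (Subtype.ext h2) ((mem_Iic.1 hr).trans_lt hs).ne'
    have hmeas : MeasurableSet (γ '' Iic t) :=
      ((isClosed_Iic (a := t)).isCompact.image γ.continuous).measurableSet
    have h1 := measure_union' (μ := Measure.hausdorffMeasure 1) hdisj hmeas
    rw [← image_union, Iic_union_Ioi, image_univ, hspeed] at h1
    have h2 : Measure.hausdorffMeasure 1 (range γ) =
        ENNReal.ofReal (t * arcDist q a b) + ENNReal.ofReal ((1 - t) * arcDist q a b) := by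
      rw [← ENNReal.ofReal_add (mul_nonneg (unitInterval.nonneg t) hL)
        (mul_nonneg (unitInterval.one_minus_nonneg t) hL)]
      ring_nf
      exact hlen
    rw [h2] at h1
    have h3 := (ENNReal.add_right_inj ENNReal.ofReal_ne_top).1 h1
    have h4 : ENNReal.ofReal (arcDist q (γ t) b) ≤
        ENNReal.ofReal ((1 - t) * arcDist q a b) := by
      rw [h3]
      calc ENNReal.ofReal (arcDist q (γ t) b) ≤ Measure.hausdorffMeasure 1 (γ '' Ici t) :=
            ofReal_arcDist_le_hausdorffMeasure hq
              (isPreconnected_Ici.image γ γ.continuous.continuousOn)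
              (image_subset_iff.2 fun s _ => hmem s) (mem_image_of_mem γ self_mem_Ici)
              ⟨1, unitInterval.le_one t, γ.target⟩
        _ ≤ Measure.hausdorffMeasure 1 (γ '' Ioi t ∪ {γ t}) := by
            refine measure_mono ?_
            rintro _ ⟨s, hs, rfl⟩
            rcases (mem_Ici.1 hs).eq_or_lt with h | h
            · exact Or.inr (by rw [h]; rfl)
            · exact Or.inl ⟨s, h, rfl⟩
        _ ≤ Measure.hausdorffMeasure 1 (γ '' Ioi t) + 0 := by
            rw [← hausdorffMeasure_one_singleton (γ t)]
            exact measure_union_le _ _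
        _ = _ := add_zero _
    exact (ENNReal.ofReal_le_ofReal_iff
      (mul_nonneg (unitInterval.one_minus_nonneg t) hL)).1 h4
  · have h1 := arcDist_triangle hq ha (hmem t) hb
    have h2 := heq t
    linarith

/-! ### The measure of a cell -/

theorem stdMeasure_compl_gasket : stdMeasure q (gasket q)ᶜ = 0 := by
  have hm := (isCompact_gasket q).measurableSet.compl
  unfold stdMeasure
  rw [Measure.map_apply (continuous_point q).measurable hm]
  have : point q ⁻¹' (gasket q)ᶜ = ∅ := by
    ext ω
    simp [gasket]
  rw [this, measure_empty]

/-- Only the `i`-th term of self-similarity contributes, so the mass equals `1 / (n + 1)` times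
itself, with a factor below one. -/
theorem stdMeasure_singleton_vertex (hn : 1 ≤ n) (hq : ∀ i j, i ≠ j → dist (q i) (q j) = 1)
    (i : Fin (n + 1)) : stdMeasure q {q i} = 0 := by
  have h := stdMeasure_selfSimilar q (measurableSet_singleton (q i))
  have h0 : ∀ j, j ≠ i → stdMeasure q (contr q j ⁻¹' {q i}) = 0 := by
    intro j hj
    refine measure_mono_null (show contr q j ⁻¹' {q i} ⊆ (gasket q)ᶜ from fun x hx hxS => ?_)
      stdMeasure_compl_gasket
    have h1 : contr q j x = q i := hx
    have h2 := congrArg (bary q i) h1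
    rw [bary_contr hq, bary_vertex hq, if_neg hj, if_pos rfl] at h2
    linarith [bary_le_one hq i hxS]
  have h1 : contr q i ⁻¹' {q i} = {q i} := by
    ext x
    refine ⟨fun hx => contr_injective (q := q) i ?_, ?_⟩
    · rw [contr_vertex]
      exact hx
    · rintro rfl
      exact contr_vertex i
  rw [Finset.sum_eq_single i (fun j _ hj => by rw [h0 j hj, mul_zero]) (by simp), h1] at h
  by_contra hne
  have hfin : stdMeasure q {q i} ≠ ⊤ := measure_ne_top _ _
  have h2 : (1 / ((n : ℝ≥0∞) + 1)) < 1 := by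
    rw [one_div, ENNReal.inv_lt_one]
    have : (0 : ℝ≥0∞) < n := by exact_mod_cast hn
    simpa using ENNReal.lt_add_right ENNReal.one_ne_top this.ne'
      |>.trans_eq (add_comm _ _)
  have h3 := ENNReal.mul_lt_mul_left hne hfin h2
  rw [one_mul] at h3
  exact h3.ne h.symm

theorem stdMeasure_cell (hn : 1 ≤ n) (hq : ∀ i j, i ≠ j → dist (q i) (q j) = 1)
    (w : List (Fin (n + 1))) : stdMeasure q (cell q w) = (1 / ((n : ℝ≥0∞) + 1)) ^ w.length := by
  induction w with
  | nil =>
    have : cell q [] = gasket q := by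
      unfold cell wordMap
      rw [image_id]
    rw [this, List.length_nil, pow_zero]
    exact (prob_compl_eq_zero_iff (isCompact_gasket q).measurableSet).1 stdMeasure_compl_gasket
  | cons i w ih =>
    have hcell : cell q (i :: w) = contr q i '' cell q w := by
      unfold cell
      rw [← image_comp]
      rfl
    rw [stdMeasure_selfSimilar q (isCompact_cell _).measurableSet, Finset.sum_eq_single i, hcell,
      preimage_image_eq _ (contr_injective i), ih, List.length_cons, pow_succ']
    · intro j _ hj
      have : stdMeasure q (contr q j ⁻¹' cell q (i :: w)) = 0 := by
        refine measure_mono_null (t := (gasket q)ᶜ ∪ {q i}) (fun x hx => ?_) ?_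
        · by_cases hxS : x ∈ gasket q
          · have hx' : contr q j x ∈ cell q (i :: w) := hx
            rw [hcell] at hx'
            obtain ⟨y, hy, hyx⟩ := hx'
            exact Or.inr (eq_vertex_of_contr_eq hq hj hxS (cell_subset_gasket w hy) hyx.symm)
          · exact Or.inl hxS
        · exact measure_union_null stdMeasure_compl_gasket (stdMeasure_singleton_vertex hn hq i)
      rw [this, mul_zero]
    · simp

/-- The exponent is the one for which `1 / (n + 1)` becomes `1 / 2`. -/
theorem stdMeasure_real_cell_rpow (hn : 1 ≤ n) (hq : ∀ i j, i ≠ j → dist (q i) (q j) = 1)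
    (w : List (Fin (n + 1))) :
    (stdMeasure q).real (cell q w) ^ (Real.log 2 / Real.log ((n : ℝ) + 1)) =
      (1 / 2) ^ w.length := by
  have hn1 : (1 : ℝ) ≤ n := by exact_mod_cast hn
  have hpos : (0 : ℝ) < (n : ℝ) + 1 := by positivity
  have h1 : (stdMeasure q).real (cell q w) = (((n : ℝ) + 1)⁻¹) ^ w.length := by
    rw [measureReal_def, stdMeasure_cell hn hq, ENNReal.toReal_pow, one_div, ENNReal.toReal_inv]
    congr 2
  have h2 : (((n : ℝ) + 1)⁻¹) ^ (Real.log 2 / Real.log ((n : ℝ) + 1)) = 1 / 2 := by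
    rw [Real.inv_rpow hpos.le, Real.rpow_def_of_pos hpos, mul_div_cancel₀, Real.exp_log two_pos,
      one_div]
    exact (Real.log_pos (by linarith)).ne'
  rw [h1, ← Real.rpow_natCast, ← Real.rpow_mul (by positivity), mul_comm, Real.rpow_mul
    (by positivity), h2, Real.rpow_natCast]

theorem lowerBound_cells (hn : 1 ≤ n) (hq : ∀ i j, i ≠ j → dist (q i) (q j) = 1) (t : I)
    (v w : List (Fin (n + 1))) : lowerBound q t (cell q v) (cell q w) =
      (1 - t) * (1 / 2) ^ v.length + t * (1 / 2) ^ w.length := by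
  unfold lowerBound
  rw [stdMeasure_real_cell_rpow hn hq, stdMeasure_real_cell_rpow hn hq]

theorem lowerBound_le_fullInterp (hn : 1 ≤ n) (hq : ∀ i j, i ≠ j → dist (q i) (q j) = 1)
    {v w : List (Fin (n + 1))} (hvw : Disjoint (cell q v) (cell q w)) (t : I) :
    ENNReal.ofReal (lowerBound q t (cell q v) (cell q w)) ≤
      Measure.hausdorffMeasure 1 (fullInterp q t (cell q v) (cell q w)) := by
  rw [lowerBound_cells hn hq]
  refine ofReal_le_hausdorffMeasure_of_between hq hvw t.2 fun a ha b hb => ?_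
  have haS := cell_subset_gasket v ha
  have hbS := cell_subset_gasket w hb
  obtain ⟨x, hx⟩ := exists_between hq t.2 haS hbS
  exact ⟨x, mem_biUnion ha (mem_biUnion hb ((mem_fullInterpPt_iff hq t haS hbS).2 hx)), hx⟩

theorem lowerBound_le_interp (hn : 1 ≤ n) (hq : ∀ i j, i ≠ j → dist (q i) (q j) = 1)
    {v w : List (Fin (n + 1))} (hvw : Disjoint (cell q v) (cell q w)) (t : I)
    {Γ : ∀ a b : EuclideanSpace ℝ (Fin n), Path a b}
    (hΓ : ∀ a ∈ cell q v, ∀ b ∈ cell q w, IsGeodesic q (Γ a b)) :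
    ENNReal.ofReal (lowerBound q t (cell q v) (cell q w)) ≤
      Measure.hausdorffMeasure 1 (interp Γ t (cell q v) (cell q w)) := by
  rw [lowerBound_cells hn hq]
  refine ofReal_le_hausdorffMeasure_of_between hq hvw t.2 fun a ha b hb => ?_
  exact ⟨Γ a b t, ⟨a, ha, b, hb, rfl⟩, (hΓ a ha b hb).1 t, (hΓ a ha b hb).arcDist_eq hq t⟩

theorem interp_subset_fullInterp (hq : ∀ i j, i ≠ j → dist (q i) (q j) = 1)
    {v w : List (Fin (n + 1))} (t : I) {Γ : ∀ a b : EuclideanSpace ℝ (Fin n), Path a b}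
    (hΓ : ∀ a ∈ cell q v, ∀ b ∈ cell q w, IsGeodesic q (Γ a b)) :
    interp Γ t (cell q v) (cell q w) ⊆ fullInterp q t (cell q v) (cell q w) := by
  rintro _ ⟨a, ha, b, hb, rfl⟩
  refine mem_biUnion ha (mem_biUnion hb ((mem_fullInterpPt_iff hq t (cell_subset_gasket v ha)
    (cell_subset_gasket w hb)).2 ⟨(hΓ a ha b hb).1 t, (hΓ a ha b hb).arcDist_eq hq t⟩))

/-! ### Sharpness for cells at two vertices -/

theorem le_bary_of_mem_cell_replicate (hq : ∀ i j, i ≠ j → dist (q i) (q j) = 1)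
    {i : Fin (n + 1)} {k : ℕ} {a : EuclideanSpace ℝ (Fin n)}
    (ha : a ∈ cell q (List.replicate k i)) : 1 - (1 / 2) ^ k ≤ bary q i a := by
  obtain ⟨x, hx, rfl⟩ := ha
  have h1 := bary_wordMap_sub hq i (List.replicate k i) x (q i)
  rw [wordMap_replicate_vertex, bary_vertex hq, if_pos rfl, List.length_replicate] at h1
  have h2 : 0 ≤ (1 / 2 : ℝ) ^ k * bary q i x := mul_nonneg (by positivity) (bary_nonneg hq i hx)
  linarith

theorem bary_le_of_mem_cell_replicate (hq : ∀ i j, i ≠ j → dist (q i) (q j) = 1)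
    {i l : Fin (n + 1)} (hil : i ≠ l) {k : ℕ} {a : EuclideanSpace ℝ (Fin n)}
    (ha : a ∈ cell q (List.replicate k i)) : bary q l a ≤ (1 / 2) ^ k := by
  have h1 := le_bary_of_mem_cell_replicate hq ha
  have h2 := bary_add_le_one hq hil (cell_subset_gasket _ ha)
  linarith

theorem cell_replicate_subset {i : Fin (n + 1)} {r k : ℕ} (h : r ≤ k) :
    cell q (List.replicate k i) ⊆ cell q (List.replicate r i) := by
  rw [← Nat.add_sub_of_le h, List.replicate_add]
  exact cell_append_subset _ _

theorem disjoint_cell_replicate (hq : ∀ i j, i ≠ j → dist (q i) (q j) = 1) {i j : Fin (n + 1)}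
    (hij : i ≠ j) {k m : ℕ} (hk : 2 ≤ k) (hm : 2 ≤ m) :
    Disjoint (cell q (List.replicate k i)) (cell q (List.replicate m j)) := by
  rw [disjoint_left]
  intro x hx hx'
  have h1 := le_bary_of_mem_cell_replicate hq (cell_replicate_subset hk hx)
  have h2 := bary_le_of_mem_cell_replicate hq hij.symm (cell_replicate_subset hm hx')
  norm_num at h1 h2
  linarith

/-- The route goes through the midpoint `F_i (q j) = F_j (q i)`, which is at distance `1/2 - bary q
j a` from `a` and `1/2 - bary q i b` from `b`. -/
theorem arcDist_le_of_mem_cell_replicate (hq : ∀ i j, i ≠ j → dist (q i) (q j) = 1)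
    {i j : Fin (n + 1)} (hij : i ≠ j) {k m : ℕ} (hk : 1 ≤ k) (hm : 1 ≤ m)
    {a b : EuclideanSpace ℝ (Fin n)} (ha : a ∈ cell q (List.replicate k i))
    (hb : b ∈ cell q (List.replicate m j)) :
    arcDist q a b ≤ 1 - bary q j a - bary q i b := by
  have hc : wordMap q [i] (q j) = wordMap q [j] (q i) := contr_vertex_comm i j
  have h1 := arcDist_cell_vertex hq j (w := [i]) (cell_replicate_subset hk ha)
  have h2 := arcDist_cell_vertex hq i (w := [j]) (cell_replicate_subset hm hb)
  have h3 := arcDist_triangle hq (cell_subset_gasket _ ha)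
    (wordMap_mem_gasket [i] (vertex_mem_gasket j)) (cell_subset_gasket _ hb)
  have h4 : bary q j (wordMap q [i] (q j)) = 1 / 2 := by
    change bary q j (contr q i (q j)) = 1 / 2
    rw [bary_contr hq, bary_vertex hq, if_pos rfl, if_neg hij, add_zero]
  have h5 : bary q i (wordMap q [j] (q i)) = 1 / 2 := by
    change bary q i (contr q j (q i)) = 1 / 2
    rw [bary_contr hq, bary_vertex hq, if_pos rfl, if_neg hij.symm, add_zero]
  rw [h4] at h1
  rw [arcDist_comm, ← hc] at h2
  rw [hc, h5, ← hc] at h2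
  linarith

/-- The way from `a` to `x` leaves `[i^r]` at a corner `l`. If `l = j`, the coordinate `j` gives the
length up to the corner and the coordinate `i` bounds the rest. The case `l = i` is only longer. -/
theorem le_arcDist_of_mem_cell_replicate (hq : ∀ i j, i ≠ j → dist (q i) (q j) = 1)
    {i j : Fin (n + 1)} (hij : i ≠ j) {r k m : ℕ} (hk : r + 2 ≤ k) (hm : r + 2 ≤ m)
    {a b x : EuclideanSpace ℝ (Fin n)} (ha : a ∈ cell q (List.replicate k i))
    (hb : b ∈ cell q (List.replicate m j)) (hx : x ∈ gasket q)
    (hbet : arcDist q a x + arcDist q x b ≤ arcDist q a b) (hax : (1 / 2) ^ r < arcDist q a x) :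
    1 - bary q i x - bary q j a ≤ arcDist q a x := by
  have haS := cell_subset_gasket _ ha
  have hbS := cell_subset_gasket _ hb
  have haC : a ∈ cell q (List.replicate r i) := cell_replicate_subset (by omega) ha
  have hxC : x ∉ cell q (List.replicate r i) := by
    intro hxC
    have := arcDist_le_of_mem_cell hq haC hxC
    rw [List.length_replicate] at this
    linarith
  obtain ⟨l, hl⟩ := exists_vertex_arcDist_add_le hq haC hx hxC
  rw [arcDist_cell_vertex hq l haC] at hl
  have hVS := wordMap_mem_gasket (List.replicate r i) (vertex_mem_gasket (q := q) l)
  have hbary : ∀ p, bary q p (wordMap q (List.replicate r i) (q l)) =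
      (if i = p then 1 else 0) + (1 / 2) ^ r * ((if l = p then 1 else 0) - if i = p then 1 else 0)
      := by
    intro p
    have := bary_wordMap_sub hq p (List.replicate r i) (q l) (q i)
    rw [wordMap_replicate_vertex, List.length_replicate, bary_vertex hq, bary_vertex hq] at this
    linarith
  have hja := bary_nonneg hq j haS
  have hi := (le_abs_self _).trans (abs_bary_sub_le_arcDist hq i hVS hx)
  rw [hbary, if_pos rfl] at hi
  rw [hbary, if_pos rfl] at hl
  by_cases hli : l = i
  · subst hli
    have := bary_le_one hq l haS
    simp only [if_true] at hi hl
    linarith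
  rw [if_neg hli] at hi
  rw [if_neg (Ne.symm hli)] at hl
  by_cases hlj : l = j
  · subst hlj
    linarith
  -- For another corner `l`, with `ρ = 2^(-r)`, reaching it takes at least `ρ - ρ/4`, and from there
  -- the coordinate `j` has to climb from `0` to at least `1 - ρ/4`. The total exceeds one, the
  -- intrinsic diameter; this is why `k` and `m` are at least `r + 2`.
  exfalso
  have h1 := (neg_abs_le _).trans' (neg_le_neg (abs_bary_sub_le_arcDist hq j hVS hx))
  rw [hbary, if_neg hij, if_neg hlj] at h1
  have h2 := (neg_abs_le _).trans' (neg_le_neg (abs_bary_sub_le_arcDist hq j hx hbS))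
  have h3 := le_bary_of_mem_cell_replicate hq (cell_replicate_subset hm hb)
  have h4 := bary_le_of_mem_cell_replicate hq (Ne.symm hli) (cell_replicate_subset hk ha)
  have h5 := arcDist_le_of_mem_cell hq (w := []) (by simpa [cell, wordMap] using haS)
    (by simpa [cell, wordMap] using hbS)
  rw [List.length_nil, pow_zero] at h5
  have h6 : (1 / 2 : ℝ) ^ (r + 2) = (1 / 2) ^ r / 4 := by
    rw [pow_add]
    norm_num
    ring
  have h7 : (0 : ℝ) < (1 / 2) ^ r := by positivity
  linarith

/-- Away from the endpoints, geodesics between two small cells at the vertices `i` and `j` run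
along the edge from `q i` to `q j`. -/
theorem eq_combination_of_between (hq : ∀ i j, i ≠ j → dist (q i) (q j) = 1)
    {i j : Fin (n + 1)} (hij : i ≠ j) {r k m : ℕ} (hk : r + 2 ≤ k) (hm : r + 2 ≤ m)
    {a b x : EuclideanSpace ℝ (Fin n)} (ha : a ∈ cell q (List.replicate k i))
    (hb : b ∈ cell q (List.replicate m j)) (hx : x ∈ gasket q)
    (hbet : arcDist q a x + arcDist q x b = arcDist q a b) (hax : (1 / 2) ^ r < arcDist q a x)
    (hxb : (1 / 2) ^ r < arcDist q x b) :
    arcDist q a b = 1 - bary q j a - bary q i b ∧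
      x = (1 - (bary q j a + arcDist q a x)) • q i + (bary q j a + arcDist q a x) • q j := by
  have haS := cell_subset_gasket _ ha
  have hbS := cell_subset_gasket _ hb
  -- Adding the lower bounds from both ends and comparing with the route through the midpoint gives
  -- `bary q i x + bary q j x ≥ 1`, so `x` is on the edge.
  have h1 := le_arcDist_of_mem_cell_replicate hq hij hk hm ha hb hx hbet.le hax
  have h2 := le_arcDist_of_mem_cell_replicate hq hij.symm hm hk hb ha hx
    (by rw [arcDist_comm b x, arcDist_comm x a, arcDist_comm b a, add_comm]; exact hbet.le)
    (by rwa [arcDist_comm b x])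
  have h3 := arcDist_le_of_mem_cell_replicate hq hij (by omega) (by omega) ha hb
  have h4 := (neg_abs_le _).trans' (neg_le_neg (abs_bary_sub_le_arcDist hq j haS hx))
  rw [arcDist_comm b x] at h2
  have h5 : bary q j a + arcDist q a x = bary q j x := by linarith
  refine ⟨by linarith, ?_⟩
  rw [h5]
  exact eq_combination_of_bary hq hij hx (by linarith)

theorem half_le_arcDist_of_mem_cell_replicate (hq : ∀ i j, i ≠ j → dist (q i) (q j) = 1)
    {i j : Fin (n + 1)} (hij : i ≠ j) {k m : ℕ} (hk : 2 ≤ k) (hm : 2 ≤ m)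
    {a b : EuclideanSpace ℝ (Fin n)} (ha : a ∈ cell q (List.replicate k i))
    (hb : b ∈ cell q (List.replicate m j)) : 1 / 2 ≤ arcDist q a b := by
  have h1 := (le_abs_self _).trans (abs_bary_sub_le_arcDist hq i (cell_subset_gasket _ ha)
    (cell_subset_gasket _ hb))
  have h2 := le_bary_of_mem_cell_replicate hq (cell_replicate_subset hk ha)
  have h3 := bary_le_of_mem_cell_replicate hq hij.symm (cell_replicate_subset hm hb)
  norm_num at h2 h3
  linarith

theorem lipschitzWith_combination (hq : ∀ i j, i ≠ j → dist (q i) (q j) = 1)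
    {i j : Fin (n + 1)} (hij : i ≠ j) :
    LipschitzWith 1 fun y : ℝ => (1 - y) • q i + y • q j := by
  refine LipschitzWith.of_dist_le_mul fun y z => ?_
  rw [dist_combination, hq i j hij, Real.dist_eq, mul_one, NNReal.coe_one, one_mul]

/-- The position on the edge is `(1-t) * bary q j a + t * (1 - bary q i b)`, where the two
coordinates range within `[0, 2^(-k)]` and `[0, 2^(-m)]`. As `a` and `b` are at least `1/2` apart,
the conditions on `t` keep the point far enough from both. -/
theorem hausdorffMeasure_fullInterp_le (hq : ∀ i j, i ≠ j → dist (q i) (q j) = 1)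
    {i j : Fin (n + 1)} (hij : i ≠ j) {r k m : ℕ} (hk : r + 2 ≤ k) (hm : r + 2 ≤ m) {t : I}
    (ht : (1 / 2) ^ r < (t : ℝ) / 2) (ht' : (1 / 2) ^ r < (1 - (t : ℝ)) / 2) :
    Measure.hausdorffMeasure 1
        (fullInterp q t (cell q (List.replicate k i)) (cell q (List.replicate m j))) ≤
      ENNReal.ofReal ((1 - t) * (1 / 2) ^ k + t * (1 / 2) ^ m) := by
  have hsub : fullInterp q t (cell q (List.replicate k i)) (cell q (List.replicate m j)) ⊆
      (fun y : ℝ => (1 - y) • q i + y • q j) ''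
        Icc (t * (1 - (1 / 2) ^ m)) ((1 - t) * (1 / 2) ^ k + t) := by
    intro x hx
    simp only [fullInterp, mem_iUnion] at hx
    obtain ⟨a, ha, b, hb, hx⟩ := hx
    obtain ⟨hxS, h1, h2⟩ := (mem_fullInterpPt_iff hq t (cell_subset_gasket _ ha)
      (cell_subset_gasket _ hb)).1 hx
    have h3 := half_le_arcDist_of_mem_cell_replicate hq hij (by omega) (by omega) ha hb
    have ht0 := unitInterval.nonneg t
    have ht1 := unitInterval.one_minus_nonneg t
    obtain ⟨h4, h5⟩ := eq_combination_of_between hq hij hk hm ha hb hxS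
      (by rw [h1, h2]; ring) (by rw [h1]; nlinarith) (by rw [h2]; nlinarith)
    have ha0 := bary_nonneg hq j (cell_subset_gasket _ ha)
    have hb0 := bary_nonneg hq i (cell_subset_gasket _ hb)
    have ha1 := bary_le_of_mem_cell_replicate hq hij ha
    have hb1 := bary_le_of_mem_cell_replicate hq hij.symm hb
    refine ⟨bary q j a + arcDist q a x, ⟨?_, ?_⟩, h5.symm⟩
    · rw [h1, h4]
      nlinarith [mul_nonneg ht1 ha0, mul_le_mul_of_nonneg_left hb1 ht0]
    · rw [h1, h4]
      nlinarith [mul_nonneg ht0 hb0, mul_le_mul_of_nonneg_left ha1 ht1]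
  refine (measure_mono hsub).trans ((hausdorffMeasure_image_Icc_le
    (lipschitzWith_combination hq hij) _ _).trans_eq ?_)
  ring_nf

/-- The segment from `(3 q_i + q_j) / 4` to `(q_i + 3 q_j) / 4`. -/
def middlePath {n : ℕ} (q : Fin (n + 1) → EuclideanSpace ℝ (Fin n)) (i j : Fin (n + 1)) :
    Path ((1 - (1 / 4 : ℝ)) • q i + (1 / 4 : ℝ) • q j)
      ((1 - (3 / 4 : ℝ)) • q i + (3 / 4 : ℝ) • q j) where
  toFun s := (1 - (1 / 4 + (s : ℝ) / 2)) • q i + (1 / 4 + (s : ℝ) / 2) • q j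
  continuous_toFun := by fun_prop
  source' := by norm_num
  target' := by norm_num

theorem range_middlePath (i j : Fin (n + 1)) : range (middlePath q i j) =
    (fun y : ℝ => (1 - y) • q i + y • q j) '' Icc (1 / 4) (3 / 4) := by
  ext x
  constructor
  · rintro ⟨s, rfl⟩
    exact ⟨1 / 4 + (s : ℝ) / 2, ⟨by linarith [s.2.1], by linarith [s.2.2]⟩, rfl⟩
  · rintro ⟨y, hy, rfl⟩
    refine ⟨⟨2 * y - 1 / 2, by linarith [hy.1], by linarith [hy.2]⟩, ?_⟩
    have : 1 / 4 + (2 * y - 1 / 2) / 2 = y := by ring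
    change (1 - (1 / 4 + (2 * y - 1 / 2) / 2)) • q i + (1 / 4 + (2 * y - 1 / 2) / 2) • q j = _
    rw [this]

theorem isCommonPath_middlePath (hq : ∀ i j, i ≠ j → dist (q i) (q j) = 1)
    {i j : Fin (n + 1)} (hij : i ≠ j) {k m : ℕ} (hk : 5 ≤ k) (hm : 5 ≤ m)
    {Γ : ∀ a b : EuclideanSpace ℝ (Fin n), Path a b}
    (hΓ : ∀ a ∈ gasket q, ∀ b ∈ gasket q, IsGeodesic q (Γ a b)) :
    IsCommonPath q (cell q (List.replicate k i)) (cell q (List.replicate m j))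
      (middlePath q i j) Γ := by
  refine ⟨fun s => ?_, ?_, fun a ha b hb => ?_⟩
  · exact combination_mem_gasket hq i j ⟨by linarith [s.2.1], by linarith [s.2.2]⟩
  · rw [pathLength, range_middlePath]
    exact (hausdorffMeasure_image_Icc_le (lipschitzWith_combination hq hij) _ _).trans_lt
      ENNReal.ofReal_lt_top
  have haS := cell_subset_gasket _ ha
  have hbS := cell_subset_gasket _ hb
  have hgeo := hΓ a haS b hbS
  refine ⟨hgeo, ?_⟩
  have ha0 := bary_nonneg hq j haS
  have hb0 := bary_nonneg hq i hbS
  have ha1 := bary_le_of_mem_cell_replicate hq hij (cell_replicate_subset hk ha)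
  have hb1 := bary_le_of_mem_cell_replicate hq hij.symm (cell_replicate_subset hm hb)
  have hhalf := half_le_arcDist_of_mem_cell_replicate hq hij (by omega) (by omega) ha hb
  norm_num at ha1 hb1
  set L := arcDist q a b with hLdef
  have hL0 : 0 < L := by linarith
  -- This is the edge description for `r = 3`, so `1/8 = 2^(-3)` and `5 = r + 2`. Positions in
  -- `[1/4, 3/4]` are at least `1/4 - 1/32` away from both ends.
  have key : ∀ s : I, 1 / 8 < s * L → 1 / 8 < (1 - s) * L →
      L = 1 - bary q j a - bary q i b ∧
        Γ a b s = (1 - (bary q j a + s * L)) • q i + (bary q j a + s * L) • q j := by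
    intro s h1 h2
    obtain ⟨e1, e2⟩ := hgeo.arcDist_eq hq s
    have := eq_combination_of_between hq hij (r := 3) hk hm ha hb (hgeo.1 s)
      (by rw [e1, e2]; ring) (by rw [e1]; norm_num; linarith) (by rw [e2]; norm_num; linarith)
    rwa [e1] at this
  have hL : L = 1 - bary q j a - bary q i b :=
    (key ⟨1 / 2, by norm_num, by norm_num⟩ (by norm_num; linarith) (by norm_num; linarith)).1
  -- The time at which the geodesic is at position `y` of the edge.
  have hmem : ∀ y ∈ Icc (1 / 4 : ℝ) (3 / 4), (y - bary q j a) / L ∈ I := fun y hy =>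
    ⟨div_nonneg (by linarith [hy.1]) hL0.le, (div_le_one hL0).2 (by linarith [hy.2])⟩
  refine ⟨⟨_, hmem (1 / 4) (by norm_num)⟩, ⟨_, hmem (3 / 4) (by norm_num)⟩, ?_⟩
  rw [range_middlePath]
  ext x
  constructor
  · rintro ⟨y, hy, rfl⟩
    have hy' := div_mul_cancel₀ (y - bary q j a) hL0.ne'
    refine ⟨⟨(y - bary q j a) / L, hmem y hy⟩, ⟨?_, ?_⟩, ?_⟩
    · exact div_le_div_of_nonneg_right (by linarith [hy.1]) hL0.le
    · exact div_le_div_of_nonneg_right (by linarith [hy.2]) hL0.le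
    · rw [(key ⟨_, hmem y hy⟩ (by simp only [hy']; linarith [hy.1])
        (by simp only [sub_mul, hy']; linarith [hy.2])).2]
      simp only [hy']
      rw [add_sub_cancel]
  · rintro ⟨s, ⟨hs1, hs2⟩, rfl⟩
    have h1 : 1 / 4 - bary q j a ≤ s * L := (div_le_iff₀ hL0).1 hs1
    have h2 : s * L ≤ 3 / 4 - bary q j a := (le_div_iff₀ hL0).1 hs2
    exact ⟨bary q j a + s * L, ⟨by linarith, by linarith⟩,
      (key s (by linarith) (by linarith)).2.symm⟩

theorem exists_geodesics (hq : ∀ i j, i ≠ j → dist (q i) (q j) = 1) :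
    ∃ Γ : ∀ a b : EuclideanSpace ℝ (Fin n), Path a b,
      ∀ a ∈ gasket q, ∀ b ∈ gasket q, IsGeodesic q (Γ a b) := by
  classical
  have h : ∀ a b : EuclideanSpace ℝ (Fin n), ∃ γ : Path a b,
      a ∈ gasket q → b ∈ gasket q → IsGeodesic q γ := by
    intro a b
    by_cases hab : a ∈ gasket q ∧ b ∈ gasket q
    · exact ⟨(reachableIn_arcDist hq hab.1 hab.2).path, fun ha hb =>
        (reachableIn_arcDist hq ha hb).isGeodesic hq ha hb⟩
    · exact ⟨PathConnectedSpace.somePath a b, fun ha hb => absurd ⟨ha, hb⟩ hab⟩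
  choose Γ hΓ using h
  exact ⟨Γ, fun a ha b hb => hΓ a b ha hb⟩

end

end SierpinskiGasket

theorem mainTheorem12 (n : ℕ) (hn : 1 ≤ n) (q : Fin (n + 1) → EuclideanSpace ℝ (Fin n))
    (hq : ∀ i j, i ≠ j → dist (q i) (q j) = 1) :
    (∀ v w : List (Fin (n + 1)),
      Disjoint (SierpinskiGasket.cell q v) (SierpinskiGasket.cell q w) →
      ∀ t : unitInterval,
        ENNReal.ofReal (SierpinskiGasket.lowerBound q t (SierpinskiGasket.cell q v)
            (SierpinskiGasket.cell q w)) ≤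
          MeasureTheory.Measure.hausdorffMeasure 1
            (SierpinskiGasket.fullInterp q t (SierpinskiGasket.cell q v)
              (SierpinskiGasket.cell q w)) ∧
        ∀ (x y : EuclideanSpace ℝ (Fin n)) (c : Path x y)
          (Γ : ∀ a b : EuclideanSpace ℝ (Fin n), Path a b),
          SierpinskiGasket.IsCommonPath q (SierpinskiGasket.cell q v)
            (SierpinskiGasket.cell q w) c Γ →
          ENNReal.ofReal (SierpinskiGasket.lowerBound q t (SierpinskiGasket.cell q v)
              (SierpinskiGasket.cell q w)) ≤
            MeasureTheory.Measure.hausdorffMeasure 1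
              (SierpinskiGasket.interp Γ t (SierpinskiGasket.cell q v)
                (SierpinskiGasket.cell q w))) ∧
    (∀ t : unitInterval, 0 < t → t < 1 →
      ∃ N : ℕ, ∀ k m : ℕ, N ≤ k → N ≤ m →
        ∃ v w : List (Fin (n + 1)), v.length = k ∧ w.length = m ∧
          Disjoint (SierpinskiGasket.cell q v) (SierpinskiGasket.cell q w) ∧
          MeasureTheory.Measure.hausdorffMeasure 1
              (SierpinskiGasket.fullInterp q t (SierpinskiGasket.cell q v)
                (SierpinskiGasket.cell q w)) =
            ENNReal.ofReal (SierpinskiGasket.lowerBound q t (SierpinskiGasket.cell q v)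
              (SierpinskiGasket.cell q w)) ∧
          ∃ (x y : EuclideanSpace ℝ (Fin n)) (c : Path x y)
            (Γ : ∀ a b : EuclideanSpace ℝ (Fin n), Path a b),
            SierpinskiGasket.IsCommonPath q (SierpinskiGasket.cell q v)
              (SierpinskiGasket.cell q w) c Γ ∧
            MeasureTheory.Measure.hausdorffMeasure 1
                (SierpinskiGasket.interp Γ t (SierpinskiGasket.cell q v)
                  (SierpinskiGasket.cell q w)) =
              ENNReal.ofReal (SierpinskiGasket.lowerBound q t (SierpinskiGasket.cell q v)
                (SierpinskiGasket.cell q w))) := by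
  refine ⟨fun v w hvw t => ⟨SierpinskiGasket.lowerBound_le_fullInterp hn hq hvw t,
    fun x y c Γ hc => SierpinskiGasket.lowerBound_le_interp hn hq hvw t
      fun a ha b hb => (hc.2.2 a ha b hb).1⟩, fun t ht0 ht1 => ?_⟩
  have h0 : (0 : ℝ) < t := ht0
  have h1 : (t : ℝ) < 1 := ht1
  obtain ⟨r, hr⟩ := exists_pow_lt_of_lt_one
    (lt_min (half_pos h0) (half_pos (sub_pos.2 h1))) (by norm_num : (1 / 2 : ℝ) < 1)
  -- The generation `r` serves the interpolant at time `t`, and `3` serves the common path.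
  refine ⟨max r 3 + 2, fun k m hk hm => ?_⟩
  have hij : (0 : Fin (n + 1)) ≠ Fin.last n := by
    rw [Ne, Fin.ext_iff, Fin.val_zero, Fin.val_last]
    omega
  have hdisj := SierpinskiGasket.disjoint_cell_replicate hq hij (k := k) (m := m) (by omega)
    (by omega)
  obtain ⟨Γ, hΓ⟩ := SierpinskiGasket.exists_geodesics hq
  have hΓ' : ∀ a ∈ SierpinskiGasket.cell q (List.replicate k 0),
      ∀ b ∈ SierpinskiGasket.cell q (List.replicate m (Fin.last n)),
      SierpinskiGasket.IsGeodesic q (Γ a b) := fun a ha b hb =>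
    hΓ a (SierpinskiGasket.cell_subset_gasket _ ha) b (SierpinskiGasket.cell_subset_gasket _ hb)
  have hle := SierpinskiGasket.hausdorffMeasure_fullInterp_le hq hij (r := r) (k := k) (m := m)
    (t := t) (by omega) (by omega) (hr.trans_le (min_le_left _ _)) (hr.trans_le (min_le_right _ _))
  have hlb := SierpinskiGasket.lowerBound_cells hn hq t (List.replicate k 0)
    (List.replicate m (Fin.last n))
  rw [List.length_replicate, List.length_replicate] at hlb
  rw [← hlb] at hle
  refine ⟨List.replicate k 0, List.replicate m (Fin.last n), List.length_replicate,
    List.length_replicate, hdisj,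
    le_antisymm hle (SierpinskiGasket.lowerBound_le_fullInterp hn hq hdisj t), _, _,
    SierpinskiGasket.middlePath q 0 (Fin.last n), Γ,
    SierpinskiGasket.isCommonPath_middlePath hq hij (by omega) (by omega) hΓ,
    le_antisymm ((measure_mono (SierpinskiGasket.interp_subset_fullInterp hq t hΓ')).trans hle)
      (SierpinskiGasket.lowerBound_le_interp hn hq hdisj t hΓ')⟩
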